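/- All graphs are finite and simple, and $\lambda(G)$ denotes the largest eigenvalue of the adjacency matrix of $G$. For a graph $H$, let $\mathrm{spex}(n,H)$ be the maximum of $\lambda(G)$ over all $n$-vertex graphs $G$ that contain no copy of $H$ as a (not necessarily induced) subgraph, and let $\mathrm{SPEX}(n,H)$ be the set of $n$-vertex graphs $G$ that contain no copy of $H$ and satisfy $\lambda(G)=\mathrm{spex}(n,H)$. Write $T\in\mathcal T^{\delta}_{m,l+1}$ if $T$ is a tree of order $m$ whose bipartition $\{A,B\}$, $|A|\le |B|$, satisfies $|A|=l+1$ and $\min_{v\in A}d_T(v)=\delta$ (if $|A|=|B|$ this minimum is $1$ for either side). For $l\ge 1$ and $m\ge 2l+2$ call positive reals $\eta,\epsilon,\alpha$ admissible if $$\eta<\min\Big\{\tfrac1{2l},\ \tfrac{\frac15-\frac1{16lm}+\frac1{20l^2m}}{m-l-1}\Big\},\qquad \epsilon<\min\Big\{\tfrac1{16l^2m},\ \tfrac{\eta}{2},\ \tfrac{\eta}{32l^2m+2}\Big\},\qquad \alpha<\min\Big\{\eta,\ \tfrac{\epsilon^2}{10m}\Big\},$$ and put $$N_0(m,l,\epsilon,\alpha)=\max\Big\{\tfrac{200m^6}{\alpha^4},\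 \tfrac{2500m^3l^2}{\alpha^3},\ \tfrac{l^2}{\epsilon^2},\ \tfrac{50m^3l}{\epsilon\alpha}\tbinom{\lfloor 50m^2l/\alpha\rfloor}{l},\ \tfrac{200m^2l}{\alpha\epsilon}\Big\}.$$ **Theorem.** There is a function $(m,l)\mapsto N=N(m,l)\in\mathbb N$ such that: 1. For all $l\ge 1$ and $m\ge 2l+2$, $N(m,l)<N_0(m,l,\epsilon,\alpha)$ for every admissible $(\eta,\epsilon,\alpha)$. Moreover $N(m,l)\le m^{(12+o_l(1))l+42}$, where $o_l(1)$ is a function of $l$ only that tends to $0$ as $l\to\infty$; and $N(m,l)\le m^{Cl}$ for an absolute constant $C$. 2. For every tree $T\in\mathcal T^{\delta}_{m,l+1}$ and every $n>N(m,l)$, every $G\in\mathrm{SPEX}(n,T)$ contains a copy of $K_{l,n-l}$. 3. Let $l\ge 1$, $T\in\mathcal T^{\delta}_{m,l+1}$, let $(\eta,\epsilon,\alpha)$ be admissible, $n\ge N_0(m,l,\epsilon,\alpha)$, and $G\in\mathrm{SPEX}(n,T)$. Let $\mathrm x$ be a nonnegative eigenvector of the adjacency matrix of $G$ for $\lambda(G)$,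 scaled so that its largest entry is $1$. Then the set $L'=\{v\in V(G):\mathrm x_v\ge\eta\}$ has exactly $l$ elements, and each of them is adjacent to every vertex outside $L'$. -/

import Mathlib

namespace SpectralTree

/-- `T` is a tree of order `m` whose smaller partite set `A` has `l + 1` vertices and for which
`δ` is the minimum of the degrees in `T` of the vertices of `A`.
(If the two partite sets have equal size, this minimum is `1` for either of them.) -/
def InTreeFamily {m : ℕ} (T : SimpleGraph (Fin m)) (l δ : ℕ) : Prop :=
  T.IsTree ∧ ∃ A : Finset (Fin m),
    T.IsBipartiteWith (A : Set (Fin m)) ((Aᶜ : Finset (Fin m)) : Set (Fin m)) ∧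
    A.card = l + 1 ∧ A.card ≤ Aᶜ.card ∧
    IsLeast {d : ℕ | ∃ v ∈ A, (T.neighborSet v).ncard = d} δ

open Classical in
/-- The (real, 0-1) adjacency matrix of a graph on `Fin n`. -/
noncomputable def adj {n : ℕ} (G : SimpleGraph (Fin n)) : Matrix (Fin n) (Fin n) ℝ :=
  G.adjMatrix ℝ

/-- The largest eigenvalue of the adjacency matrix of `G`
(the spectrum is finite, and nonempty when `n ≥ 1`, so the supremum is a maximum). -/
noncomputable def lam {n : ℕ} (G : SimpleGraph (Fin n)) : ℝ :=
  sSup (spectrum ℝ (adj G))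

/-- The maximum of `lam G` over all graphs `G` on `n` vertices containing no copy of `H`
(there are finitely many such graphs, so the supremum is a maximum). -/
noncomputable def spex {W : Type*} (n : ℕ) (H : SimpleGraph W) : ℝ :=
  sSup {r : ℝ | ∃ G : SimpleGraph (Fin n), H.Free G ∧ lam G = r}

/-- The graphs on `n` vertices that contain no copy of `H` and attain `spex n H`. -/
def SPEX {W : Type*} (n : ℕ) (H : SimpleGraph W) : Set (SimpleGraph (Fin n)) :=
  {G | H.Free G ∧ lam G = spex n H}

/-- `x` is a nonnegative eigenvector of the adjacency matrix of `G` for its largest eigenvalue,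
normalized so that its largest entry is `1`. (For connected `G` there is exactly one such
vector, and all its entries are positive.) -/
def IsPerronVector {n : ℕ} (G : SimpleGraph (Fin n)) (x : Fin n → ℝ) : Prop :=
  (∀ v, 0 ≤ x v) ∧ (adj G).mulVec x = lam G • x ∧ IsGreatest (Set.range x) 1

/-- The conditions on the positive constants `η`, `ε`, `α` (used only for `l ≥ 1`,
`m ≥ 2 l + 2`, where no denominator vanishes). -/
def Admissible (m l : ℕ) (η ε α : ℝ) : Prop :=
  0 < η ∧ 0 < ε ∧ 0 < α ∧
  η < min (1 / (2 * (l : ℝ)))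
    ((1 / 5 - 1 / (16 * (l : ℝ) * m) + 1 / (20 * (l : ℝ) ^ 2 * m)) / ((m : ℝ) - l - 1)) ∧
  ε < min (1 / (16 * (l : ℝ) ^ 2 * m)) (min (η / 2) (η / (32 * (l : ℝ) ^ 2 * m + 2))) ∧
  α < min η (ε ^ 2 / (10 * m))

/-- The explicit threshold. The upper entry of the binomial coefficient is rounded down. -/
noncomputable def threshold (m l : ℕ) (ε α : ℝ) : ℝ :=
  max (200 * (m : ℝ) ^ 6 / α ^ 4)
    (max (2500 * (m : ℝ) ^ 3 * (l : ℝ) ^ 2 / α ^ 3)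
      (max ((l : ℝ) ^ 2 / ε ^ 2)
        (max (50 * (m : ℝ) ^ 3 * l / (ε * α) *
            (Nat.choose ⌊50 * (m : ℝ) ^ 2 * l / α⌋₊ l : ℝ))
          (200 * (m : ℝ) ^ 2 * l / (α * ε)))))

end SpectralTree

/-! A `T`-free graph is sparse on every vertex set, by greedy embedding (`sum_degree_le`), and it
has no `K_{l+1,m}`, which contains `T`. Extremality gives `λ² ≥ l(n-l)`, since `K_{l,n-l}` is itself
`T`-free (`splitGraph_free`).

The main tool is to count two-step walks weighted by the Perron vector. Sparsity first shows that
the set `L` of vertices of weight at least `10α` has size bounded independently of `n`. Since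
`K_{l+1,m}` is absent, all but boundedly many neighbours of a vertex `v` see fewer than `l` other
vertices of `L` (`card_bad_le`). Comparing walks from `v` with `λ² x_v` then gives degree at least
`(x_v - σ)n` for a small `σ`. For a vertex `z` of weight 1 it shows that its typical neighbour sees
nearly the maximal weight `l - 1` in `L` besides `z`. A vertex of weight at least `η` shares a
positive proportion of these neighbours, so its own weight is close to 1 (`one_sub_le`). There are
at least `l` such vertices, as otherwise a typical neighbour of `z` would lose weight 1/2, and at
most `l`, as `l + 1` of them would have more than `m` common neighbours.

For completeness of the adjacency, take among the vertices missing some heavy neighbour one with few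
neighbours of the same kind. Its light neighbours together weigh less than the missing heavy one, so
rewiring it to the heavy set keeps `T` absent and raises `λ` (`rewire_free`, `lam_lt_lam_rewire`), a
contradiction. -/

namespace SpectralTree

open Finset
open scoped Classical

/-! ### Sparsity of graphs without a given tree -/

/-- A tree embeds greedily into a vertex set inducing a graph of large minimum degree. -/
theorem exists_copy_of_minDegree {V : Type*} (G : SimpleGraph V) (S : Finset V)
    (hS : S.Nonempty) (k : ℕ) :
    ∀ (W : Type) [Fintype W] (T : SimpleGraph W), T.IsTree → Fintype.card W = k + 1 →
      (∀ v ∈ S, k ≤ #{u ∈ S | G.Adj v u}) →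
      ∃ f : W → V, Function.Injective f ∧ (∀ w, f w ∈ S) ∧ ∀ a b, T.Adj a b → G.Adj (f a) (f b) := by
  induction k with
  | zero =>
    intro W _ T hT hW _
    obtain ⟨s, hs⟩ := hS
    have : Subsingleton W := Fintype.card_le_one_iff_subsingleton.1 (by omega)
    exact ⟨fun _ => s, Function.injective_of_subsingleton _, fun _ => hs,
      fun a b hab => absurd (Subsingleton.elim a b) hab.ne⟩
  | succ k ih =>
    intro W _ T hT hW hdeg
    have : Nontrivial W := Fintype.one_lt_card_iff_nontrivial.1 (by omega)
    obtain ⟨w, hw⟩ := hT.exists_vert_degree_one_of_nontrivial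
    have hT' : (T.induce ({w}ᶜ : Set W)).IsTree :=
      ⟨hT.1.induce_compl_singleton_of_degree_eq_one hw, hT.2.induce _⟩
    obtain ⟨p, hp, hpu⟩ := SimpleGraph.degree_eq_one_iff_existsUnique_adj.1 hw
    obtain ⟨f, hf, hfS, hfa⟩ := ih ({w}ᶜ : Set W) (T.induce ({w}ᶜ : Set W)) hT'
      (by rw [Fintype.card_compl_set]; simp; omega)
      (fun v hv => (Nat.le_succ k).trans (hdeg v hv))
    have hpw : p ≠ w := hp.ne'
    -- The image of the parent `p` need not be avoided, since a neighbour of it differs from it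
    -- anyway. Only `k` images remain, so degree `k + 1` suffices.
    have hcard : #((univ.erase (⟨p, hpw⟩ : ({w}ᶜ : Set W))).image f) < k + 1 := by
      refine card_image_le.trans_lt ?_
      rw [card_erase_of_mem (mem_univ _), card_univ, Fintype.card_compl_set]
      simp; omega
    obtain ⟨y, hy, hy'⟩ := exists_mem_notMem_of_card_lt_card (hcard.trans_le (hdeg _ (hfS ⟨p, hpw⟩)))
    rw [mem_filter] at hy
    have hyf : ∀ q, f q ≠ y := by
      intro q hq
      by_cases h : q = ⟨p, hpw⟩
      · subst h; exact hy.2.ne hq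
      · exact hy' (mem_image.2 ⟨q, mem_erase.2 ⟨h, mem_univ _⟩, hq⟩)
    refine ⟨fun a => if h : a = w then y else f ⟨a, h⟩, ?_, ?_, ?_⟩
    · intro a b hab
      by_cases ha : a = w <;> by_cases hb : b = w <;> simp only [ha, hb, dite_true, dite_false] at hab ⊢
      · exact absurd hab.symm (hyf _)
      · exact absurd hab (hyf _)
      · exact Subtype.mk.inj (hf hab)
    · intro a
      by_cases ha : a = w <;> simp only [ha, dite_true, dite_false]
      · exact hy.1
      · exact hfS _
    · intro a b hab
      by_cases ha : a = w <;> by_cases hb : b = w <;> simp only [ha, hb, dite_true, dite_false]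
      · exact absurd (ha.trans hb.symm) hab.ne
      · subst ha
        have := hpu b hab
        subst this
        exact hy.2.symm
      · subst hb
        have := hpu a hab.symm
        subst this
        exact hy.2
      · exact hfa _ _ hab

/-- In a graph without a copy of a tree on `m` vertices every nonempty vertex set induces a
subgraph with a vertex of degree at most `m - 2`. -/
theorem exists_degree_lt {V : Type*} {m : ℕ} {T : SimpleGraph (Fin m)} (hT : T.IsTree)
    {G : SimpleGraph V} (hG : T.Free G) {S : Finset V} (hS : S.Nonempty) :
    ∃ v ∈ S, #{u ∈ S | G.Adj v u} + 1 < m := by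
  by_contra! h
  have : Nonempty (Fin m) := hT.1.nonempty
  obtain ⟨k, rfl⟩ : ∃ k, m = k + 1 := ⟨m - 1, by have := Fin.pos_iff_nonempty.2 this; omega⟩
  obtain ⟨f, hf, -, hfa⟩ := exists_copy_of_minDegree G S hS k (Fin (k + 1)) T hT (by simp)
    (fun v hv => by have := h v hv; omega)
  exact hG ⟨⟨⟨f, fun {a b} => hfa a b⟩, hf⟩⟩

/-- A graph without a copy of a tree on `m` vertices is sparse on every vertex set. -/
theorem sum_degree_le {V : Type*} {m : ℕ} {T : SimpleGraph (Fin m)} (hT : T.IsTree)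
    {G : SimpleGraph V} (hG : T.Free G) (S : Finset V) :
    ∑ v ∈ S, #{u ∈ S | G.Adj v u} ≤ 2 * m * #S := by
  induction hk : #S generalizing S with
  | zero => simp [card_eq_zero.1 hk]
  | succ k ih =>
    -- Peel off a vertex of low degree; the degree sum drops by twice its degree.
    obtain ⟨v, hv, hvd⟩ := exists_degree_lt hT hG (card_pos.1 (by omega : 0 < #S))
    have h1 := ih (S.erase v) (by rw [card_erase_of_mem hv]; omega)
    have h2 : ∀ u ∈ S.erase v, #{w ∈ S | G.Adj u w}
        = #{w ∈ S.erase v | G.Adj u w} + if G.Adj v u then 1 else 0 := by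
      intro u hu
      rw [filter_erase]
      split_ifs with h
      · rw [card_erase_add_one]
        exact mem_filter.2 ⟨hv, h.symm⟩
      · rw [erase_eq_of_notMem, add_zero]
        exact fun h' => h (mem_filter.1 h').2.symm
    have h3 : ∑ u ∈ S.erase v, (if G.Adj v u then 1 else 0) ≤ #{u ∈ S | G.Adj v u} := by
      rw [sum_boole, Nat.cast_id]
      exact card_le_card (filter_subset_filter _ (erase_subset _ _))
    rw [← add_sum_erase S _ hv, sum_congr rfl h2, sum_add_distrib]
    nlinarith

/-- All edges of `T` run between `A` and its complement, so any injections of `A` into `W` and of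
the complement into `P` give a copy. -/
theorem isContained_of_common_neighbors {V : Type*} {m l δ : ℕ} {T : SimpleGraph (Fin m)}
    (hT : InTreeFamily T l δ) {G : SimpleGraph V} {W P : Finset V} (hW : #W = l + 1)
    (hP : m ≤ #P + (l + 1)) (h : ∀ w ∈ W, ∀ p ∈ P, G.Adj w p) : T.IsContained G := by
  obtain ⟨-, A, hA, hAc, -, -⟩ := hT
  have hd : Disjoint W P := disjoint_left.2 fun a ha hb => (h a ha a hb).ne rfl
  obtain ⟨f⟩ : Nonempty (A ↪ W) := Function.Embedding.nonempty_of_card_le (by simp [hW, hAc])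
  obtain ⟨g⟩ : Nonempty ((Aᶜ : Finset (Fin m)) ↪ P) :=
    Function.Embedding.nonempty_of_card_le (by simp [hAc]; omega)
  refine ⟨⟨⟨fun a => if ha : a ∈ A then (f ⟨a, ha⟩ : V) else g ⟨a, mem_compl.2 ha⟩, ?_⟩, ?_⟩⟩
  · intro a b hab
    by_cases ha : a ∈ A
    · have hb : b ∉ A := by
        have := hA.mem_of_mem_adj (mem_coe.2 ha) hab
        simpa using this
      simp only [ha, hb, dite_true, dite_false]
      exact h _ (f _).2 _ (g _).2
    · have hb : b ∈ A := by
        have := hA.mem_of_mem_adj' (w := a) (v := b) (by simpa using ha) hab.symm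
        simpa using this
      simp only [ha, hb, dite_true, dite_false]
      exact (h _ (f _).2 _ (g _).2).symm
  · intro a b hab
    change (if ha : a ∈ A then (f ⟨a, ha⟩ : V) else g ⟨a, mem_compl.2 ha⟩)
      = (if ha : b ∈ A then (f ⟨b, ha⟩ : V) else g ⟨b, mem_compl.2 ha⟩) at hab
    by_cases ha : a ∈ A <;> by_cases hb : b ∈ A <;> simp only [ha, hb, dite_true, dite_false] at hab
    · simpa using f.injective (Subtype.ext hab)
    · exact absurd (hab ▸ (f _).2) (disjoint_right.1 hd (g _).2)
    · exact absurd (hab ▸ (g _).2) (disjoint_left.1 hd (f _).2)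
    · simpa using g.injective (Subtype.ext hab)

/-! ### Rayleigh quotients and Perron vectors -/

theorem adj_mulVec {n : ℕ} (G : SimpleGraph (Fin n)) (x : Fin n → ℝ) (v : Fin n) :
    (adj G).mulVec x v = ∑ u ∈ G.neighborFinset v, x u := by
  simp [adj, SimpleGraph.adjMatrix_mulVec_apply]

theorem adj_isHermitian {n : ℕ} (G : SimpleGraph (Fin n)) : (adj G).IsHermitian := by
  unfold adj
  rw [Matrix.IsHermitian, Matrix.conjTranspose_eq_transpose_of_trivial]
  exact SimpleGraph.transpose_adjMatrix _

theorem spectrum_adj_finite {n : ℕ} (G : SimpleGraph (Fin n)) : (spectrum ℝ (adj G)).Finite :=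
  Matrix.finite_real_spectrum

theorem mem_spectrum_of_mulVec {n : ℕ} {A : Matrix (Fin n) (Fin n) ℝ} {r : ℝ} {x : Fin n → ℝ}
    (hx : x ≠ 0) (h : A.mulVec x = r • x) : r ∈ spectrum ℝ A := by
  rw [← Matrix.spectrum_toLin']
  refine Module.End.HasEigenvalue.mem_spectrum
    (Module.End.hasEigenvalue_of_hasEigenvector (x := x) ⟨?_, hx⟩)
  rw [Module.End.mem_eigenspace_iff]
  simpa using h

theorem exists_mulVec_of_mem_spectrum {n : ℕ} {A : Matrix (Fin n) (Fin n) ℝ} {r : ℝ}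
    (h : r ∈ spectrum ℝ A) : ∃ x : Fin n → ℝ, x ≠ 0 ∧ A.mulVec x = r • x := by
  rw [← Matrix.spectrum_toLin', ← Module.End.hasEigenvalue_iff_mem_spectrum] at h
  obtain ⟨x, hx⟩ := h.exists_hasEigenvector
  exact ⟨x, hx.2, by simpa using hx.apply_eq_smul⟩

theorem le_lam {n : ℕ} {G : SimpleGraph (Fin n)} {r : ℝ} {x : Fin n → ℝ}
    (hx : x ≠ 0) (h : (adj G).mulVec x = r • x) : r ≤ lam G :=
  le_csSup (spectrum_adj_finite G).bddAbove (mem_spectrum_of_mulVec hx h)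

theorem posSemidef_sub_adj {n : ℕ} {G : SimpleGraph (Fin n)} {r : ℝ} (h : lam G ≤ r) :
    (r • (1 : Matrix (Fin n) (Fin n) ℝ) - adj G).PosSemidef := by
  have hH : (r • (1 : Matrix (Fin n) (Fin n) ℝ) - adj G).IsHermitian := by
    refine Matrix.IsHermitian.sub ?_ (adj_isHermitian G)
    rw [Matrix.IsHermitian]; simp
  rw [hH.posSemidef_iff_eigenvalues_nonneg]
  intro i
  obtain ⟨x, hx, hxe⟩ := exists_mulVec_of_mem_spectrum (hH.eigenvalues_mem_spectrum_real i)
  have : r - hH.eigenvalues i ≤ lam G := by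
    refine le_lam hx ?_
    rw [Matrix.sub_mulVec, Matrix.smul_mulVec, Matrix.one_mulVec] at hxe
    rw [sub_smul, ← hxe]; abel
  simp only [Pi.zero_apply]
  linarith

/-- The equality case of the Rayleigh bound: a zero of the form of a positive semidefinite matrix
lies in its kernel. It yields both the Perron vector and the strict increase under rewiring. -/
theorem mulVec_eq_of_quadratic_form_ge {n : ℕ} {G : SimpleGraph (Fin n)} {r : ℝ} (h : lam G ≤ r)
    {x : Fin n → ℝ} (hx : r * (x ⬝ᵥ x) ≤ x ⬝ᵥ (adj G).mulVec x) : (adj G).mulVec x = r • x := by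
  have hP := posSemidef_sub_adj h
  have h0 := hP.dotProduct_mulVec_nonneg x
  have h1 := (hP.dotProduct_mulVec_zero_iff x)
  simp only [star_trivial, Matrix.sub_mulVec, Matrix.smul_mulVec, Matrix.one_mulVec,
    dotProduct_sub, dotProduct_smul, smul_eq_mul] at h0 h1
  exact (sub_eq_zero.1 (h1.1 (by linarith))).symm

/-- Passing from an eigenvector to its absolute values keeps the norm and does not decrease the
quadratic form, so the result is again an eigenvector. -/
theorem exists_isPerronVector {n : ℕ} (hn : 0 < n) (G : SimpleGraph (Fin n)) :
    ∃ x, IsPerronVector G x := by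
  have : Nonempty (Fin n) := Fin.pos_iff_nonempty.1 hn
  have hne : (spectrum ℝ (adj G)).Nonempty :=
    ⟨_, (adj_isHermitian G).eigenvalues_mem_spectrum_real (Classical.arbitrary _)⟩
  obtain ⟨y, hy0, hy⟩ := exists_mulVec_of_mem_spectrum (hne.csSup_mem (spectrum_adj_finite G))
  have hy' : (adj G).mulVec y = lam G • y := hy
  set z : Fin n → ℝ := fun v => |y v| with hz
  have hzz : z ⬝ᵥ z = y ⬝ᵥ y := by simp [dotProduct, hz]
  have hzA : (adj G).mulVec z = lam G • z := by
    refine mulVec_eq_of_quadratic_form_ge le_rfl ?_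
    have : lam G * (z ⬝ᵥ z) = y ⬝ᵥ (adj G).mulVec y := by rw [hy', hzz, dotProduct_smul, smul_eq_mul]
    rw [this]
    simp only [dotProduct, adj_mulVec]
    refine sum_le_sum fun v _ => ?_
    calc y v * ∑ u ∈ G.neighborFinset v, y u ≤ |y v * ∑ u ∈ G.neighborFinset v, y u| := le_abs_self _
      _ = |y v| * |∑ u ∈ G.neighborFinset v, y u| := abs_mul _ _
      _ ≤ |y v| * ∑ u ∈ G.neighborFinset v, |y u| :=
        mul_le_mul_of_nonneg_left (abs_sum_le_sum_abs _ _) (abs_nonneg _)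
  obtain ⟨v, hv⟩ := Finite.exists_max z
  have hvpos : 0 < z v := by
    obtain ⟨w, hw⟩ := Function.ne_iff.1 hy0
    exact (abs_pos.2 hw).trans_le (hv w)
  refine ⟨(z v)⁻¹ • z, fun w => ?_, ?_, ⟨v, ?_⟩, ?_⟩
  · exact mul_nonneg (inv_nonneg.2 hvpos.le) (abs_nonneg _)
  · rw [Matrix.mulVec_smul, hzA, smul_comm]
  · simp [hvpos.ne']
  · rintro _ ⟨w, rfl⟩
    simp only [Pi.smul_apply, smul_eq_mul]
    rw [inv_mul_le_iff₀ hvpos, mul_one]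
    exact hv w

/-! ### The comparison graph `K_{l,n-l}` -/

/-- The complete bipartite graph on `Fin n` with one side consisting of the first `l` vertices. -/
def splitGraph (n l : ℕ) : SimpleGraph (Fin n) where
  Adj a b := (a.val < l ∧ l ≤ b.val) ∨ (b.val < l ∧ l ≤ a.val)
  symm := ⟨fun a b h => h.symm⟩
  loopless := ⟨fun a h => by omega⟩

/-- A connected graph has only one bipartition up to swapping sides. A copy would therefore place a
whole side of `T`, of size at least `l + 1`, among the first `l` vertices. -/
theorem splitGraph_free {m l δ n : ℕ} {T : SimpleGraph (Fin m)} (hT : InTreeFamily T l δ) :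
    T.Free (splitGraph n l) := by
  rintro ⟨f⟩
  obtain ⟨hTt, A, hA, hAc, hAle, -⟩ := hT
  set S : Finset (Fin m) := univ.filter fun a => (f a).val < l with hS
  have hSl : #S ≤ l := by
    have h1 : #(S.image fun a => (f a).val) ≤ #(range l) := by
      refine card_le_card fun k hk => ?_
      obtain ⟨a, ha, rfl⟩ := mem_image.1 hk
      exact mem_range.2 (mem_filter.1 ha).2
    rw [card_range, card_image_of_injective _ (f := fun a => (f a).val)
      (Fin.val_injective.comp f.injective)] at h1
    exact h1
  have hstep : ∀ a b, T.Adj a b → ((a ∈ A ↔ a ∈ S) ↔ (b ∈ A ↔ b ∈ S)) := by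
    intro a b hab
    have h1 : (a ∈ A ↔ b ∉ A) := by
      constructor
      · intro ha
        have := hA.mem_of_mem_adj (mem_coe.2 ha) hab
        simpa using this
      · intro hb
        have := hA.mem_of_mem_adj' (w := b) (v := a) (by simpa using hb) hab
        simpa using this
    have h2 : (a ∈ S ↔ b ∉ S) := by
      have h3 := f.toHom.map_adj hab
      change (_ ∧ _) ∨ (_ ∧ _) at h3
      simp only [hS, mem_filter, mem_univ, true_and]
      change (f a).val < l ∧ l ≤ (f b).val ∨ (f b).val < l ∧ l ≤ (f a).val at h3
      omega
    tauto
  have hconst : ∀ a b, ((a ∈ A ↔ a ∈ S) ↔ (b ∈ A ↔ b ∈ S)) := by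
    intro a b
    obtain ⟨p⟩ := hTt.1.preconnected a b
    induction p with
    | nil => exact Iff.rfl
    | cons h _ ih => exact (hstep _ _ h).trans ih
  obtain ⟨a, ha⟩ := card_pos.1 (by omega : 0 < #A)
  by_cases haS : a ∈ S
  · have : A ⊆ S := fun b hb => by have := hconst a b; tauto
    have := card_le_card this
    omega
  · have : Aᶜ ⊆ S := fun b hb => by have := hconst a b; have := mem_compl.1 hb; tauto
    have := card_le_card this
    omega

theorem sqrt_le_lam_splitGraph {n l : ℕ} (hl : 0 < l) (hln : l < n) :
    Real.sqrt (l * (n - l)) ≤ lam (splitGraph n l) := by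
  have h1 : (0:ℝ) ≤ l := by positivity
  have h2 : (0:ℝ) < (n:ℝ) - l := sub_pos.2 (by exact_mod_cast hln)
  have hlow : #(univ.filter fun u : Fin n => u.val < l) = l := by
    rw [Fin.card_filter_val_lt]; omega
  have hhigh : #(univ.filter fun u : Fin n => ¬ u.val < l) = n - l := by
    have := card_filter_add_card_filter_not (s := (univ : Finset (Fin n))) (fun u => u.val < l)
    rw [hlow, card_univ, Fintype.card_fin] at this
    omega
  -- The eigenvector is constant on each side, with values in the ratio `√(n-l) : √l`.
  refine le_lam (x := fun v => if v.val < l then Real.sqrt (n - l) else Real.sqrt l) ?_ ?_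
  · intro h
    have := congrFun h ⟨l, hln⟩
    simp at this
    omega
  · ext v
    rw [adj_mulVec, Pi.smul_apply, smul_eq_mul]
    have hr : Real.sqrt (l * (n - l)) = Real.sqrt l * Real.sqrt (n - l) := Real.sqrt_mul h1 _
    by_cases hv : v.val < l
    · have hN : (splitGraph n l).neighborFinset v = univ.filter fun u : Fin n => ¬ u.val < l := by
        ext u
        rw [SimpleGraph.mem_neighborFinset, mem_filter_univ]
        simp only [splitGraph]
        omega
      rw [hN, sum_congr rfl (g := fun _ => Real.sqrt l)
        (fun u hu => if_neg (mem_filter.1 hu).2), sum_const, hhigh, if_pos hv, hr, nsmul_eq_mul,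
        Nat.cast_sub hln.le, mul_assoc, Real.mul_self_sqrt h2.le, mul_comm]
    · have hN : (splitGraph n l).neighborFinset v = univ.filter fun u : Fin n => u.val < l := by
        ext u
        rw [SimpleGraph.mem_neighborFinset, mem_filter_univ]
        simp only [splitGraph]
        omega
      rw [hN, sum_congr rfl (g := fun _ => Real.sqrt (n - l))
        (fun u hu => if_pos (mem_filter.1 hu).2), sum_const, hlow, if_neg hv, hr, nsmul_eq_mul,
        mul_right_comm, Real.mul_self_sqrt h1]

theorem le_spex {W : Type*} {n : ℕ} {H : SimpleGraph W} {G : SimpleGraph (Fin n)}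
    (h : H.Free G) : lam G ≤ spex n H := by
  refine le_csSup ((Set.finite_range (fun G : SimpleGraph (Fin n) => lam G)).subset ?_).bddAbove
    ⟨G, h, rfl⟩
  rintro _ ⟨G, -, rfl⟩
  exact ⟨G, rfl⟩

theorem mul_le_lam_sq {m l δ n : ℕ} {T : SimpleGraph (Fin m)} (hT : InTreeFamily T l δ)
    (hl : 0 < l) (hln : l < n) {G : SimpleGraph (Fin n)} (hG : G ∈ SPEX n T) :
    0 < lam G ∧ (l : ℝ) * (n - l) ≤ lam G ^ 2 := by
  have h1 := (sqrt_le_lam_splitGraph hl hln).trans (le_spex (splitGraph_free hT))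
  rw [← hG.2] at h1
  have hl' : (0:ℝ) < l := by exact_mod_cast hl
  have h2 : (0:ℝ) < (l:ℝ) * (n - l) := mul_pos hl' (sub_pos.2 (by exact_mod_cast hln))
  exact ⟨(Real.sqrt_pos.2 h2).trans_le h1, (Real.sqrt_le_left ((Real.sqrt_nonneg _).trans h1)).1 h1⟩

/-! ### Counting two-step walks -/

/-- A graph without a copy of `T` together with a nonnegative eigenvector `x` with entries at most
`1` for an eigenvalue `r` that is at least the spectral radius of `K_{l, n - l}`. -/
structure PerronSetting {m n : ℕ} (T : SimpleGraph (Fin m)) (l : ℕ) (G : SimpleGraph (Fin n))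
    (x : Fin n → ℝ) (r : ℝ) : Prop where
  family : ∃ δ, InTreeFamily T l δ
  free : T.Free G
  nonneg : ∀ v, 0 ≤ x v
  le_one : ∀ v, x v ≤ 1
  eig : ∀ v, r * x v = ∑ u ∈ G.neighborFinset v, x u
  pos : 0 < r
  sq : (l : ℝ) * (n - l) ≤ r ^ 2
  l_pos : 1 ≤ l

theorem InTreeFamily.two_mul_add_two_le {m l δ : ℕ} {T : SimpleGraph (Fin m)}
    (hT : InTreeFamily T l δ) : 2 * l + 2 ≤ m := by
  obtain ⟨-, A, -, h1, h2, -⟩ := hT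
  rw [card_compl, Fintype.card_fin] at h2
  omega

theorem card_commonNeighbors_ge {n : ℕ} {G : SimpleGraph (Fin n)} {S : Finset (Fin n)} {τ : ℝ}
    (h : ∀ v ∈ S, (n : ℝ) - τ ≤ #(G.neighborFinset v)) :
    (n : ℝ) - #S * τ ≤ #{u | ∀ v ∈ S, G.Adj v u} := by
  have h1 : (univ.filter fun u => ¬ ∀ v ∈ S, G.Adj v u) ⊆ S.biUnion fun v => (G.neighborFinset v)ᶜ := by
    intro u hu
    obtain ⟨v, hv, hvu⟩ : ∃ v ∈ S, ¬ G.Adj v u := by simpa using hu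
    exact mem_biUnion.2 ⟨v, hv, by simpa using hvu⟩
  have h2 : (#(univ.filter fun u => ¬ ∀ v ∈ S, G.Adj v u) : ℝ) ≤ ∑ v ∈ S, (#((G.neighborFinset v)ᶜ) : ℝ) := by
    exact_mod_cast (card_le_card h1).trans card_biUnion_le
  have h3 : ∑ v ∈ S, (#((G.neighborFinset v)ᶜ) : ℝ) ≤ ∑ v ∈ S, τ := by
    refine sum_le_sum fun v hv => ?_
    rw [card_compl, Fintype.card_fin, Nat.cast_sub (by simpa using card_le_univ (G.neighborFinset v))]
    linarith [h v hv]
  have h4 := card_filter_add_card_filter_not (s := (univ : Finset (Fin n))) (fun u => ∀ v ∈ S, G.Adj v u)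
  rw [card_univ, Fintype.card_fin] at h4
  have h5 : (#{u | ∀ v ∈ S, G.Adj v u} : ℝ) + #(univ.filter fun u => ¬ ∀ v ∈ S, G.Adj v u) = n := by
    exact_mod_cast h4
  rw [sum_const, nsmul_eq_mul] at h3
  linarith

namespace PerronSetting

variable {m n l : ℕ} {T : SimpleGraph (Fin m)} {G : SimpleGraph (Fin n)} {x : Fin n → ℝ} {r : ℝ}

theorem sum_card_neighborFinset_le (P : PerronSetting T l G x r) :
    ∑ v, (#(G.neighborFinset v) : ℝ) ≤ 2 * m * n := by
  obtain ⟨δ, hT⟩ := P.family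
  have := sum_degree_le hT.1 P.free univ
  rw [card_univ, Fintype.card_fin] at this
  have h2 : ∀ v, G.neighborFinset v = univ.filter fun u => G.Adj v u := fun v => by
    ext u; simp
  simp only [h2]
  exact_mod_cast this

theorem sum_subset_card_neighborFinset_le (P : PerronSetting T l G x r) (S : Finset (Fin n)) :
    ∑ v ∈ S, (#(G.neighborFinset v) : ℝ) ≤ 2 * m * n :=
  (sum_le_sum_of_subset_of_nonneg (subset_univ S) fun _ _ _ => Nat.cast_nonneg _).trans
    P.sum_card_neighborFinset_le

theorem sq_mul_eq (P : PerronSetting T l G x r) (v : Fin n) :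
    r ^ 2 * x v = ∑ u ∈ G.neighborFinset v, ∑ w ∈ G.neighborFinset u, x w := by
  rw [pow_two, mul_assoc, P.eig v, mul_sum]
  exact sum_congr rfl fun u _ => P.eig u

theorem mul_le_card_neighborFinset (P : PerronSetting T l G x r) (v : Fin n) :
    r * x v ≤ #(G.neighborFinset v) := by
  rw [P.eig v]
  calc _ ≤ ∑ u ∈ G.neighborFinset v, (1 : ℝ) := sum_le_sum fun u _ => P.le_one u
    _ = _ := by simp

/-- The sum is at most the degree sum inside the union of the neighbourhood and `M`, so sparsity
makes it linear in the two sizes. -/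
theorem sum_card_inter_le (P : PerronSetting T l G x r) (v : Fin n) (M : Finset (Fin n)) :
    ∑ u ∈ G.neighborFinset v, (#(G.neighborFinset u ∩ M) : ℝ)
      ≤ 2 * m * (#(G.neighborFinset v) + #M) := by
  obtain ⟨δ, hT⟩ := P.family
  set S := G.neighborFinset v ∪ M
  have h1 : ∑ u ∈ G.neighborFinset v, #(G.neighborFinset u ∩ M) ≤ ∑ u ∈ S, #{w ∈ S | G.Adj u w} := by
    refine (sum_le_sum fun u _ => card_le_card fun w hw => ?_).trans
      (sum_le_sum_of_subset subset_union_left)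
    rw [mem_inter, SimpleGraph.mem_neighborFinset] at hw
    exact mem_filter.2 ⟨mem_union_right _ hw.2, hw.1⟩
  have h2 := h1.trans ((sum_degree_le hT.1 P.free S).trans
    (Nat.mul_le_mul_left _ (card_union_le (G.neighborFinset v) M)))
  exact_mod_cast h2

/-- A vertex of weight at least `β` has linear degree. -/
theorem card_neighborFinset_ge_of_le (P : PerronSetting T l G x r) (hm : 0 < m) (hn : 2 * l ≤ n)
    {β : ℝ} (hβ : 0 < β) (hnβ : 131072 * (m : ℝ) ^ 6 < n * β ^ 4) {v : Fin n} (hv : β ≤ x v) :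
    β * n / (16 * m) ≤ #(G.neighborFinset v) := by
  have hm' : (0 : ℝ) < m := by exact_mod_cast hm
  have hl' : (1 : ℝ) ≤ l := by exact_mod_cast P.l_pos
  have hnl : (2 : ℝ) * l ≤ n := by exact_mod_cast hn
  have hn0 : (0 : ℝ) < n := by linarith
  have hr2 : (n : ℝ) / 2 ≤ r ^ 2 := by nlinarith [P.sq]
  -- With this cutoff the walks ending at light vertices contribute at most `βn/4`, half of the
  -- available `βn/2`.
  set γ := β / (8 * m) with hγ
  have hγ0 : 0 < γ := by positivity
  have hγβ : 8 * m * γ = β := by rw [hγ]; field_simp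
  set M : Finset (Fin n) := univ.filter fun w => γ ≤ x w with hM
  have hMcard : r * γ * #M ≤ 2 * m * n := by
    refine le_trans ?_ (P.sum_subset_card_neighborFinset_le M)
    calc r * γ * #M = ∑ w ∈ M, r * γ := by rw [sum_const, nsmul_eq_mul]; ring
      _ ≤ _ := sum_le_sum fun w hw => le_trans
        (mul_le_mul_of_nonneg_left (mem_filter.1 hw).2 P.pos.le) (P.mul_le_card_neighborFinset w)
  -- `hMcard` and `r² ≥ n/2` bound `#M` by order `√n`; the constant `131072 = 2 · 256²` makes this
  -- small enough.
  have hMsmall : 16 * m * (#M : ℝ) ≤ β * n := by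
    by_contra! hlt
    have h1 : r * β ^ 2 < 256 * (m : ℝ) ^ 3 := by
      have : r * γ * (β * n) < 16 * m * (2 * m * n) := by
        have := mul_lt_mul_of_pos_left hlt (mul_pos P.pos hγ0)
        nlinarith
      have h2 : r * (8 * m * γ) * β < 256 * (m : ℝ) ^ 3 := by
        have h3 : n * (r * (8 * m * γ) * β) < n * (256 * (m : ℝ) ^ 3) := by
          have := mul_lt_mul_of_pos_left this (by positivity : (0:ℝ) < 8 * m)
          linarith
        exact lt_of_mul_lt_mul_left h3 hn0.le
      rw [hγβ] at h2
      linarith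
    have h2 : (r * β ^ 2) ^ 2 < (256 * (m : ℝ) ^ 3) ^ 2 :=
      pow_lt_pow_left₀ h1 (mul_nonneg P.pos.le (by positivity)) two_ne_zero
    have h3 : (n : ℝ) / 2 * β ^ 4 ≤ r ^ 2 * β ^ 4 := mul_le_mul_of_nonneg_right hr2 (by positivity)
    nlinarith
  have hwalk : r ^ 2 * x v ≤ 2 * m * (#(G.neighborFinset v) + #M) + γ * (2 * m * n) := by
    rw [P.sq_mul_eq v]
    calc ∑ u ∈ G.neighborFinset v, ∑ w ∈ G.neighborFinset u, x w
        ≤ ∑ u ∈ G.neighborFinset v, ((#(G.neighborFinset u ∩ M) : ℝ) + γ * #(G.neighborFinset u)) := by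
          refine sum_le_sum fun u _ => ?_
          calc ∑ w ∈ G.neighborFinset u, x w
              ≤ ∑ w ∈ G.neighborFinset u, ((if w ∈ M then 1 else 0) + γ) := by
                refine sum_le_sum fun w _ => ?_
                split_ifs with h
                · linarith [P.le_one w]
                · have : ¬ γ ≤ x w := fun h' => h (mem_filter.2 ⟨mem_univ _, h'⟩)
                  linarith
            _ = _ := by
                rw [sum_add_distrib, sum_const, nsmul_eq_mul, sum_boole, filter_mem_eq_inter]
                ring
      _ ≤ _ := by
          rw [sum_add_distrib, ← mul_sum]
          exact add_le_add (P.sum_card_inter_le v M)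
            (mul_le_mul_of_nonneg_left (P.sum_subset_card_neighborFinset_le _) hγ0.le)
  have h4 : (n : ℝ) / 2 * β ≤ r ^ 2 * x v := mul_le_mul hr2 hv hβ.le (by positivity)
  rw [div_le_iff₀ (by positivity)]
  have h5 : γ * (2 * m * n) = β * n / 4 := by rw [← hγβ]; ring
  nlinarith

/-- Linear degrees and linearly many edges leave room for only boundedly many such vertices. -/
theorem card_heavy_le (P : PerronSetting T l G x r) (hm : 0 < m) (hn : 2 * l ≤ n)
    {β : ℝ} (hβ : 0 < β) (hnβ : 131072 * (m : ℝ) ^ 6 < n * β ^ 4) :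
    β * (#{v | β ≤ x v} : ℝ) ≤ 32 * (m : ℝ) ^ 2 := by
  have hm' : (0 : ℝ) < m := by exact_mod_cast hm
  have hn0 : (0 : ℝ) < n := by exact_mod_cast (by have := P.l_pos; omega : 0 < n)
  have h1 : (#{v | β ≤ x v} : ℝ) * (β * n / (16 * m)) ≤ 2 * m * n := by
    refine le_trans ?_ (P.sum_subset_card_neighborFinset_le {v | β ≤ x v})
    rw [← nsmul_eq_mul, ← sum_const]
    exact sum_le_sum fun v hv =>
      P.card_neighborFinset_ge_of_le hm hn hβ hnβ (mem_filter.1 hv).2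
  have h2 : n * (β * (#{v | β ≤ x v} : ℝ)) ≤ n * (32 * (m : ℝ) ^ 2) := by
    have := mul_le_mul_of_nonneg_right h1 (by positivity : (0:ℝ) ≤ 16 * m)
    field_simp at this
    nlinarith
  exact le_of_mul_le_mul_left h2 hn0

/-- Few neighbours of `v` have `l` or more further neighbours in a given small set. -/
theorem card_bad_le (P : PerronSetting T l G x r) (L : Finset (Fin n)) (v : Fin n) :
    #{u ∈ G.neighborFinset v | l ≤ #(G.neighborFinset u ∩ L.erase v)} ≤ m * (#L).choose l := by
  obtain ⟨δ, hT⟩ := P.family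
  by_contra! hlt
  set B := {u ∈ G.neighborFinset v | l ≤ #(G.neighborFinset u ∩ L.erase v)} with hB
  have hch : ∀ u ∈ B, ∃ W, W ⊆ G.neighborFinset u ∩ L.erase v ∧ #W = l := fun u hu =>
    exists_subset_card_eq (mem_filter.1 hu).2
  choose! W hWs hWc using hch
  -- Pigeonhole: more than `m` bad neighbours share the same `l`-set `Y`, and with `v` this is a
  -- forbidden `K_{l+1,m}`.
  obtain ⟨Y, hY, hYc⟩ := exists_lt_card_fiber_of_mul_lt_card_of_maps_to (s := B)
    (t := (L.erase v).powersetCard l) (f := W) (n := m)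
    (fun u hu => mem_powersetCard.2 ⟨(hWs u hu).trans inter_subset_right, hWc u hu⟩)
    (by
      rw [card_powersetCard]
      refine lt_of_le_of_lt ?_ hlt
      rw [mul_comm]
      exact Nat.mul_le_mul_left _ (Nat.choose_le_choose _ (card_le_card (erase_subset _ _))))
  rw [mem_powersetCard] at hY
  refine P.free (isContained_of_common_neighbors hT (W := insert v Y) (P := {u ∈ B | W u = Y})
    ?_ (by omega) ?_)
  · rw [card_insert_of_notMem, hY.2]
    exact fun h => notMem_erase v L (hY.1 h)
  · intro w hw u hu
    obtain ⟨huB, hWu⟩ := mem_filter.1 hu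
    rcases mem_insert.1 hw with rfl | hw
    · simpa using (mem_filter.1 huB).1
    · rw [← hWu] at hw
      have := (mem_inter.1 (hWs u huB hw)).1
      rw [SimpleGraph.mem_neighborFinset] at this
      exact this.symm

end PerronSetting

/-! ### Degrees, weights and number of the heavy vertices -/

namespace PerronSetting

variable {m n l : ℕ} {T : SimpleGraph (Fin m)} {G : SimpleGraph (Fin n)} {x : Fin n → ℝ} {r : ℝ}

/-- The neighbours of `v` having fewer than `l` neighbours in `L` besides `v`. -/
noncomputable def goodNeighbors (G : SimpleGraph (Fin n)) (l : ℕ) (L : Finset (Fin n)) (v : Fin n) :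
    Finset (Fin n) :=
  {u ∈ G.neighborFinset v | #(G.neighborFinset u ∩ L.erase v) < l}

/-- The total weight of the neighbours of `u` in `L` other than `v`. -/
noncomputable def heavySum (G : SimpleGraph (Fin n)) (x : Fin n → ℝ) (L : Finset (Fin n))
    (v u : Fin n) : ℝ :=
  ∑ w ∈ G.neighborFinset u ∩ L.erase v, x w

theorem heavySum_le_card (P : PerronSetting T l G x r) (L : Finset (Fin n)) (v u : Fin n) :
    heavySum G x L v u ≤ #(G.neighborFinset u ∩ L.erase v) := by
  calc _ ≤ ∑ w ∈ G.neighborFinset u ∩ L.erase v, (1 : ℝ) := sum_le_sum fun w _ => P.le_one w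
    _ = _ := by simp

theorem heavySum_le_of_mem (P : PerronSetting T l G x r) {L : Finset (Fin n)} {v u : Fin n}
    (hu : u ∈ goodNeighbors G l L v) : heavySum G x L v u ≤ l - 1 := by
  refine (P.heavySum_le_card L v u).trans ?_
  have : (#(G.neighborFinset u ∩ L.erase v) : ℝ) + 1 ≤ l := by exact_mod_cast (mem_filter.1 hu).2
  linarith

theorem card_neighborFinset_le (P : PerronSetting T l G x r) (L : Finset (Fin n)) (v : Fin n) :
    (#(G.neighborFinset v) : ℝ) ≤ #(goodNeighbors G l L v) + m * (#L).choose l := by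
  have h1 := card_filter_add_card_filter_not (s := G.neighborFinset v)
    (fun u => #(G.neighborFinset u ∩ L.erase v) < l)
  have h2 := P.card_bad_le L v
  simp only [not_lt] at h1
  rw [← h1, goodNeighbors]
  exact_mod_cast Nat.add_le_add_left h2 _

/-- Counting walks of length two from `v`. -/
theorem walk_bound (P : PerronSetting T l G x r) {L : Finset (Fin n)} {β σ : ℝ} (hβ : 0 ≤ β)
    (hL : ∀ w ∉ L, x w ≤ β)
    (hσ : (m : ℝ) * (#L).choose l * #L + 2 * m * β * n + (l : ℝ) ^ 2 ≤ σ * n) (v : Fin n) :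
    (l : ℝ) * n * x v
      ≤ #(G.neighborFinset v) * x v + ∑ u ∈ goodNeighbors G l L v, heavySum G x L v u + σ * n := by
  have h1 : ∀ u ∈ G.neighborFinset v, ∑ w ∈ G.neighborFinset u, x w
      ≤ x v + heavySum G x L v u + β * #(G.neighborFinset u) := by
    -- A walk through `u` returns to `v`, ends elsewhere in `L`, or ends at a vertex of weight at
    -- most `β`.
    intro u hu
    have hv : v ∈ G.neighborFinset u := by
      rw [SimpleGraph.mem_neighborFinset] at hu ⊢; exact hu.symm
    calc ∑ w ∈ G.neighborFinset u, x w
        ≤ ∑ w ∈ G.neighborFinset u, ((if w = v then x w else 0)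
            + (if w ∈ L.erase v then x w else 0) + β) := by
          refine sum_le_sum fun w _ => ?_
          by_cases hwv : w = v
          · simp [hwv, hβ]
          · by_cases hwL : w ∈ L
            · simp [hwv, hwL, hβ]
            · simpa [hwv, hwL] using hL w hwL
      _ = _ := by
          rw [sum_add_distrib, sum_add_distrib, sum_ite_eq', if_pos hv, sum_const, nsmul_eq_mul,
            heavySum, ← filter_mem_eq_inter, sum_filter]
          ring
  have h2 : ∑ u ∈ G.neighborFinset v, heavySum G x L v u
      ≤ ∑ u ∈ goodNeighbors G l L v, heavySum G x L v u + m * (#L).choose l * #L := by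
    rw [← sum_filter_add_sum_filter_not (G.neighborFinset v)
      (fun u => #(G.neighborFinset u ∩ L.erase v) < l)]
    refine add_le_add le_rfl ?_
    simp only [not_lt]
    calc _ ≤ ∑ u ∈ G.neighborFinset v with l ≤ #(G.neighborFinset u ∩ L.erase v), (#L : ℝ) := by
          refine sum_le_sum fun u _ => (P.heavySum_le_card L v u).trans ?_
          exact_mod_cast card_le_card (inter_subset_right.trans (erase_subset _ _))
      _ ≤ _ := by
          rw [sum_const, nsmul_eq_mul]
          refine mul_le_mul_of_nonneg_right ?_ (Nat.cast_nonneg _)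
          exact_mod_cast P.card_bad_le L v
  have h3 : r ^ 2 * x v ≤ #(G.neighborFinset v) * x v
      + (∑ u ∈ goodNeighbors G l L v, heavySum G x L v u + m * (#L).choose l * #L)
      + β * (2 * m * n) := by
    rw [P.sq_mul_eq v]
    refine (sum_le_sum h1).trans ?_
    rw [sum_add_distrib, sum_add_distrib, sum_const, nsmul_eq_mul, ← mul_sum]
    exact add_le_add (add_le_add le_rfl h2)
      (mul_le_mul_of_nonneg_left (P.sum_subset_card_neighborFinset_le _) hβ)
  have h4 := mul_le_mul_of_nonneg_right P.sq (P.nonneg v)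
  have h5 : (l : ℝ) ^ 2 * x v ≤ (l : ℝ) ^ 2 := mul_le_of_le_one_right (by positivity) (P.le_one v)
  nlinarith

/-- Vertices of large weight have large degree. -/
theorem card_neighborFinset_ge (P : PerronSetting T l G x r) {L : Finset (Fin n)} {β σ : ℝ}
    (hβ : 0 ≤ β) (hL : ∀ w ∉ L, x w ≤ β)
    (hσ : (m : ℝ) * (#L).choose l * #L + 2 * m * β * n + (l : ℝ) ^ 2 ≤ σ * n) (v : Fin n) :
    (x v - σ) * n ≤ #(G.neighborFinset v) := by
  have hl' : (1 : ℝ) ≤ l := by exact_mod_cast P.l_pos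
  have h1 := P.walk_bound hβ hL hσ v
  -- Each good neighbour contributes at most `l - 1` and each return at most 1, so `l n x_v ≤ l d(v)
  -- + σn`.
  have h2 : ∑ u ∈ goodNeighbors G l L v, heavySum G x L v u ≤ (l - 1) * #(G.neighborFinset v) := by
    calc _ ≤ ∑ u ∈ goodNeighbors G l L v, ((l : ℝ) - 1) := sum_le_sum fun u hu => P.heavySum_le_of_mem hu
      _ = (l - 1) * #(goodNeighbors G l L v) := by rw [sum_const, nsmul_eq_mul, mul_comm]
      _ ≤ _ := mul_le_mul_of_nonneg_left
          (by exact_mod_cast card_le_card (filter_subset _ _)) (by linarith)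
  have h3 : (#(G.neighborFinset v) : ℝ) * x v ≤ #(G.neighborFinset v) :=
    mul_le_of_le_one_right (Nat.cast_nonneg _) (P.le_one v)
  have hσn : 0 ≤ σ * n := le_trans (by positivity) hσ
  have h4 : (l : ℝ) * ((x v - σ) * n) ≤ l * #(G.neighborFinset v) := by nlinarith
  exact le_of_mul_le_mul_left h4 (by linarith)

/-- The neighbours of a vertex of weight `1` see almost the largest possible weight in `L`. -/
theorem sum_deficit_le (P : PerronSetting T l G x r) {L : Finset (Fin n)} {β σ : ℝ} (hβ : 0 ≤ β)
    (hL : ∀ w ∉ L, x w ≤ β)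
    (hσ : (m : ℝ) * (#L).choose l * #L + 2 * m * β * n + (l : ℝ) ^ 2 ≤ σ * n) {z : Fin n}
    (hz : x z = 1) :
    ∑ u ∈ goodNeighbors G l L z, ((l : ℝ) - 1 - heavySum G x L z u) ≤ σ * n := by
  have hl' : (1 : ℝ) ≤ l := by exact_mod_cast P.l_pos
  have h1 := P.walk_bound hβ hL hσ z
  rw [hz] at h1
  rw [sum_sub_distrib, sum_const, nsmul_eq_mul]
  have h2 : (#(goodNeighbors G l L z) : ℝ) ≤ #(G.neighborFinset z) := by
    exact_mod_cast card_le_card (filter_subset _ _)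
  have h3 : (#(G.neighborFinset z) : ℝ) ≤ n := by
    exact_mod_cast (card_le_univ (G.neighborFinset z)).trans_eq (by simp)
  nlinarith

/-- A vertex of weight at least `η` has weight close to `1`. -/
theorem one_sub_le (P : PerronSetting T l G x r) {L : Finset (Fin n)} {β σ η : ℝ} (hβ : 0 ≤ β)
    (hn : 0 < n) (hL : ∀ w ∉ L, x w ≤ β)
    (hσ : (m : ℝ) * (#L).choose l * #L + 2 * m * β * n + (l : ℝ) ^ 2 ≤ σ * n) {z v : Fin n}
    (hz : x z = 1) (hvL : v ∈ L) (hv : η ≤ x v) :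
    (1 - x v) * (η - 3 * σ) ≤ σ := by
  have hn' : (0 : ℝ) < n := by exact_mod_cast hn
  have hσn : 0 ≤ σ * n := le_trans (by positivity) hσ
  have hσ0 : 0 ≤ σ := nonneg_of_mul_nonneg_left hσn hn'
  by_cases hvz : v = z
  · rw [hvz, hz]; simpa using hσ0
  have hL1 : (1 : ℝ) ≤ #L := by exact_mod_cast card_pos.2 ⟨v, hvL⟩
  have hbad : (m : ℝ) * (#L).choose l ≤ σ * n := by
    have h1 : (m : ℝ) * (#L).choose l ≤ m * (#L).choose l * #L := le_mul_of_one_le_right (by positivity) hL1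
    have h2 : 0 ≤ 2 * m * β * n := by positivity
    nlinarith
  set C := goodNeighbors G l L z ∩ G.neighborFinset v with hC
  -- One `σ` is lost in each of the degree of `z`, the degree of `v`, and the number of bad
  -- neighbours of `z`.
  have hCcard : (η - 3 * σ) * n ≤ #C := by
    have h1 := P.card_neighborFinset_ge hβ hL hσ z
    have h2 := P.card_neighborFinset_ge hβ hL hσ v
    have h3 := P.card_neighborFinset_le L z
    have h4 : (#(goodNeighbors G l L z) : ℝ) + #(G.neighborFinset v) ≤ #C + n := by
      have h5 := card_union_add_card_inter (goodNeighbors G l L z) (G.neighborFinset v)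
      have h6 := (card_le_univ (goodNeighbors G l L z ∪ G.neighborFinset v)).trans_eq (Fintype.card_fin n)
      rw [← hC] at h5
      exact_mod_cast (by omega : #(goodNeighbors G l L z) + #(G.neighborFinset v) ≤ #C + n)
    rw [hz] at h1
    have h7 := mul_le_mul_of_nonneg_right hv hn'.le
    nlinarith
  -- One of the at most `l - 1` vertices that `u` sees is `v`, so the deficit at `u` is at least `1
  -- - x_v`.
  have hdef : ∀ u ∈ C, 1 - x v ≤ (l : ℝ) - 1 - heavySum G x L z u := by
    intro u hu
    obtain ⟨hug, huv⟩ := mem_inter.1 hu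
    have hmem : v ∈ G.neighborFinset u ∩ L.erase z := by
      rw [SimpleGraph.mem_neighborFinset] at huv
      exact mem_inter.2 ⟨by rw [SimpleGraph.mem_neighborFinset]; exact huv.symm,
        mem_erase.2 ⟨hvz, hvL⟩⟩
    have h1 : heavySum G x L z u ≤ x v + #((G.neighborFinset u ∩ L.erase z).erase v) := by
      rw [heavySum, ← add_sum_erase _ _ hmem]
      refine add_le_add le_rfl ?_
      calc _ ≤ ∑ w ∈ (G.neighborFinset u ∩ L.erase z).erase v, (1 : ℝ) :=
            sum_le_sum fun w _ => P.le_one w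
        _ = _ := by simp
    have h2 : (#((G.neighborFinset u ∩ L.erase z).erase v) : ℝ) + 2 ≤ l := by
      have h3 := card_erase_add_one hmem
      have h4 := (mem_filter.1 hug).2
      exact_mod_cast (by omega : #((G.neighborFinset u ∩ L.erase z).erase v) + 2 ≤ l)
    linarith
  have h1 : #C * (1 - x v) ≤ σ * n := by
    refine le_trans ?_ (P.sum_deficit_le hβ hL hσ hz)
    rw [← nsmul_eq_mul, ← sum_const]
    refine (sum_le_sum hdef).trans (sum_le_sum_of_subset_of_nonneg inter_subset_left fun u hu _ => ?_)
    linarith [P.heavySum_le_of_mem hu]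
  have h2 := mul_le_mul_of_nonneg_right hCcard (by linarith [P.le_one v] : 0 ≤ 1 - x v)
  have h3 : n * ((1 - x v) * (η - 3 * σ)) ≤ n * σ := by nlinarith
  exact le_of_mul_le_mul_left h3 hn'

/-- There are at least `l` vertices of weight at least `η`. -/
theorem le_card_veryHeavy (P : PerronSetting T l G x r) {L : Finset (Fin n)} {β σ η : ℝ}
    (hβ : 0 ≤ β) (hn : 0 < n) (hL : ∀ w ∉ L, x w ≤ β)
    (hσ : (m : ℝ) * (#L).choose l * #L + 2 * m * β * n + (l : ℝ) ^ 2 ≤ σ * n) {z : Fin n}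
    (hz : x z = 1) (hzL : z ∈ L) (hη : η ≤ 1 / 2) (hσ4 : σ < 1 / 4) :
    l ≤ #{v | η ≤ x v} := by
  by_contra! hlt
  have hn' : (0 : ℝ) < n := by exact_mod_cast hn
  have hσn : 0 ≤ σ * n := le_trans (by positivity) hσ
  have hL1 : (1 : ℝ) ≤ #L := by exact_mod_cast card_pos.2 ⟨z, hzL⟩
  have hbad : (m : ℝ) * (#L).choose l ≤ σ * n := by
    have h1 : (m : ℝ) * (#L).choose l ≤ m * (#L).choose l * #L := le_mul_of_one_le_right (by positivity) hL1
    have h2 : 0 ≤ 2 * m * β * n := by positivity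
    nlinarith
  set H : Finset (Fin n) := {v | η ≤ x v} with hH
  have hzH : z ∈ H := mem_filter.2 ⟨mem_univ _, by rw [hz]; linarith⟩
  have hHz : #(H.erase z) + 2 ≤ l := by
    have := card_erase_add_one hzH
    omega
  -- At most `l - 2` vertices other than `z` have weight at least `η`, so any further vertex that
  -- `u` sees weighs at most 1/2.
  have hdef : ∀ u ∈ goodNeighbors G l L z, 1 / 2 ≤ (l : ℝ) - 1 - heavySum G x L z u := by
    intro u hu
    set Q := G.neighborFinset u ∩ L.erase z with hQ
    have hQl : #Q < l := (mem_filter.1 hu).2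
    have h1 : heavySum G x L z u ≤ #(Q ∩ H.erase z) + η * #(Q \ H.erase z) := by
      rw [heavySum, ← hQ, ← sum_inter_add_sum_sdiff Q (H.erase z)]
      refine add_le_add ?_ ?_
      · calc _ ≤ ∑ w ∈ Q ∩ H.erase z, (1 : ℝ) := sum_le_sum fun w _ => P.le_one w
          _ = _ := by simp
      · calc _ ≤ ∑ w ∈ Q \ H.erase z, η := sum_le_sum fun w hw => ?_
          _ = _ := by rw [sum_const, nsmul_eq_mul, mul_comm]
        obtain ⟨hwQ, hwH⟩ := mem_sdiff.1 hw
        by_contra! h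
        exact hwH (mem_erase.2 ⟨(mem_erase.1 (mem_inter.1 hwQ).2).1,
          mem_filter.2 ⟨mem_univ _, h.le⟩⟩)
    have h2 : (#(Q ∩ H.erase z) : ℝ) + #(Q \ H.erase z) + 1 ≤ l := by
      have := card_inter_add_card_sdiff Q (H.erase z)
      exact_mod_cast (by omega : #(Q ∩ H.erase z) + #(Q \ H.erase z) + 1 ≤ l)
    have h3 : (#(Q ∩ H.erase z) : ℝ) + 2 ≤ l := by
      have : #(Q ∩ H.erase z) ≤ #(H.erase z) := card_le_card inter_subset_right
      exact_mod_cast (by omega : #(Q ∩ H.erase z) + 2 ≤ l)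
    have h4 : η * #(Q \ H.erase z) ≤ 1 / 2 * #(Q \ H.erase z) :=
      mul_le_mul_of_nonneg_right hη (Nat.cast_nonneg _)
    linarith
  have h1 : #(goodNeighbors G l L z) * (1 / 2 : ℝ) ≤ σ * n := by
    refine le_trans ?_ (P.sum_deficit_le hβ hL hσ hz)
    rw [← nsmul_eq_mul, ← sum_const]
    exact sum_le_sum hdef
  have h2 := P.card_neighborFinset_ge hβ hL hσ z
  have h3 := P.card_neighborFinset_le L z
  rw [hz] at h2
  -- There are at least `(1 - 2σ)n` good neighbours, each with deficit 1/2, against a total of `σn`: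
  -- this would force `σ ≥ 1/4`.
  have h4 := mul_lt_mul_of_pos_right hσ4 hn'
  linarith

end PerronSetting

/-! ### Rewiring a vertex to the heavy set -/

/-- The graph obtained from `G` by replacing the neighbourhood of `w` with `S`. -/
def rewire {n : ℕ} (G : SimpleGraph (Fin n)) (w : Fin n) (S : Finset (Fin n)) : SimpleGraph (Fin n) where
  Adj a b := (a ≠ w ∧ b ≠ w ∧ G.Adj a b) ∨ (a = w ∧ b ≠ w ∧ b ∈ S) ∨ (b = w ∧ a ≠ w ∧ a ∈ S)
  symm := ⟨fun a b h => by have := G.adj_comm a b; tauto⟩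
  loopless := ⟨fun a h => by have := G.irrefl (v := a); tauto⟩

/-- In a copy using `w`, replace `w` by a common neighbour of `S` outside the copy; this produces a
copy in `G`. -/
theorem rewire_free {V : Type*} [Fintype V] {T : SimpleGraph V} {n : ℕ} {G : SimpleGraph (Fin n)}
    (hG : T.Free G) {w : Fin n} {S : Finset (Fin n)}
    (hc : Fintype.card V < #{u | ∀ v ∈ S, G.Adj v u}) : T.Free (rewire G w S) := by
  rintro ⟨f⟩
  have hadj : ∀ a b, T.Adj a b → (f a ≠ w ∧ f b ≠ w ∧ G.Adj (f a) (f b)) ∨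
      (f a = w ∧ f b ≠ w ∧ f b ∈ S) ∨ (f b = w ∧ f a ≠ w ∧ f a ∈ S) :=
    fun a b h => f.toHom.map_adj h
  obtain ⟨y, hy, hyf⟩ := exists_mem_notMem_of_card_lt_card
    ((card_image_le (s := (univ : Finset V)) (f := f)).trans_lt hc)
  have hy' : ∀ v ∈ S, G.Adj v y := (mem_filter.1 hy).2
  have hyf' : ∀ a, f a ≠ y := fun a h => hyf (mem_image.2 ⟨a, mem_univ _, h⟩)
  refine hG ⟨⟨⟨fun a => if f a = w then y else f a, fun {a b} hab => ?_⟩, fun a b hab => ?_⟩⟩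
  · rcases hadj a b hab with ⟨h1, h2, h3⟩ | ⟨h1, h2, h3⟩ | ⟨h1, h2, h3⟩
    · simpa only [h1, h2, if_false] using h3
    · simp only [h1, h2, if_true, if_false]
      exact (hy' _ h3).symm
    · simp only [h1, h2, if_true, if_false]
      exact hy' _ h3
  · change (if f a = w then y else f a) = (if f b = w then y else f b) at hab
    split_ifs at hab with h1 h2 h2
    · exact f.injective (h1.trans h2.symm)
    · exact absurd hab.symm (hyf' _)
    · exact absurd hab (hyf' _)
    · exact f.injective hab

/-- The quadratic form at `x` changes by `2 x_w (∑_S x - λ x_w) ≥ 0`. This may vanish when `x_w =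
0`, so strictness comes from the eigenvalue equation at `w`, which fails in the new graph. -/
theorem lam_lt_lam_rewire {n : ℕ} {G : SimpleGraph (Fin n)} {w : Fin n} {S : Finset (Fin n)}
    {x : Fin n → ℝ} (hx : ∀ v, 0 ≤ x v) (he : (adj G).mulVec x = lam G • x) (hw : w ∉ S)
    (h : lam G * x w < ∑ v ∈ S, x v) : lam G < lam (rewire G w S) := by
  by_contra! hle
  have hew : ∀ v, ∑ u ∈ G.neighborFinset v, x u = lam G * x v := fun v => by
    rw [← adj_mulVec, he, Pi.smul_apply, smul_eq_mul]
  have hNw : (rewire G w S).neighborFinset w = S := by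
    ext u
    rw [SimpleGraph.mem_neighborFinset]
    change _ ∨ _ ↔ _
    have : u ∈ S → u ≠ w := by rintro hu rfl; exact hw hu
    tauto
  have hN : ∀ v, ∑ u ∈ (rewire G w S).neighborFinset v, x u = ∑ u ∈ G.neighborFinset v, x u
      + (if v ∈ S then x w else 0) - (if v ∈ G.neighborFinset w then x w else 0)
      + (if v = w then ∑ u ∈ S, x u - ∑ u ∈ G.neighborFinset w, x u else 0) := by
    intro v
    by_cases hv : v = w
    · subst hv
      rw [hNw]
      simp [hw]
    · have h1 : ∑ u ∈ (rewire G w S).neighborFinset v, x u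
          = ∑ u ∈ (G.neighborFinset v).erase w, x u + if v ∈ S then x w else 0 := by
        have h2 : (rewire G w S).neighborFinset v = (G.neighborFinset v).erase w ∪
            if v ∈ S then {w} else ∅ := by
          ext u
          rw [SimpleGraph.mem_neighborFinset, mem_union, mem_erase, SimpleGraph.mem_neighborFinset]
          change _ ∨ _ ↔ _
          split_ifs with hS
          · rw [mem_singleton]; tauto
          · simp only [notMem_empty]; tauto
        rw [h2, sum_union]
        · split_ifs <;> simp
        · split_ifs <;> simp
      rw [h1, if_neg hv, add_zero]
      have h3 : (v ∈ G.neighborFinset w) ↔ w ∈ G.neighborFinset v := by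
        simp [SimpleGraph.adj_comm]
      by_cases hwv : w ∈ G.neighborFinset v
      · rw [if_pos (h3.2 hwv), ← add_sum_erase _ _ hwv]; ring
      · rw [if_neg (fun h => hwv (h3.1 h)), erase_eq_of_notMem hwv]; ring
  have hq : x ⬝ᵥ (adj (rewire G w S)).mulVec x
      = lam G * (x ⬝ᵥ x) + 2 * (x w * (∑ v ∈ S, x v - lam G * x w)) := by
    simp only [dotProduct, adj_mulVec, hN, hew]
    have : ∀ v, x v * (lam G * x v + (if v ∈ S then x w else 0)
        - (if v ∈ G.neighborFinset w then x w else 0)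
        + (if v = w then ∑ u ∈ S, x u - lam G * x w else 0))
        = lam G * (x v * x v) + (if v ∈ S then x v else 0) * x w
          - (if v ∈ G.neighborFinset w then x v else 0) * x w
          + (if v = w then x v else 0) * (∑ u ∈ S, x u - lam G * x w) := by
      intro v
      split_ifs <;> ring
    simp only [this]
    rw [sum_add_distrib, sum_sub_distrib, sum_add_distrib, ← mul_sum, ← sum_mul, ← sum_mul,
      ← sum_mul, sum_ite_mem, sum_ite_mem, sum_ite_eq', univ_inter, univ_inter, if_pos (mem_univ _),
      hew]
    ring
  have heq := mulVec_eq_of_quadratic_form_ge hle (x := x) (by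
    rw [hq]
    have := mul_nonneg (hx w) (sub_pos.2 h).le
    linarith)
  have := congrFun heq w
  rw [adj_mulVec, hNw, Pi.smul_apply, smul_eq_mul] at this
  linarith

theorem IsPerronVector.perronSetting {m l δ n : ℕ} {T : SimpleGraph (Fin m)}
    (hT : InTreeFamily T l δ) (hl : 1 ≤ l) (hln : l < n) {G : SimpleGraph (Fin n)}
    (hG : G ∈ SPEX n T) {x : Fin n → ℝ} (hx : IsPerronVector G x) :
    PerronSetting T l G x (lam G) where
  family := ⟨δ, hT⟩
  free := hG.1
  nonneg := hx.1
  le_one v := hx.2.2.2 ⟨v, rfl⟩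
  eig v := by rw [← adj_mulVec, hx.2.1, Pi.smul_apply, smul_eq_mul]
  pos := (mul_le_lam_sq hT hl hln hG).1
  sq := (mul_le_lam_sq hT hl hln hG).2
  l_pos := hl

/-- In a spectral extremal graph, `l` vertices of large weight with many common neighbours are
adjacent to all other vertices, provided these have small weight. -/
theorem adj_of_heavy {m l δ n : ℕ} {T : SimpleGraph (Fin m)} (hT : InTreeFamily T l δ)
    {G : SimpleGraph (Fin n)} (hG : G ∈ SPEX n T) {x : Fin n → ℝ} (hx : ∀ v, 0 ≤ x v)
    (he : (adj G).mulVec x = lam G • x) {H : Finset (Fin n)} (hH : #H = l) {η : ℝ} (hη0 : 0 ≤ η)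
    (hη : η * ((m : ℝ) - l - 1) ≤ 1 / 5) (hxH : ∀ v ∈ H, 3 / 5 < x v) (hxH' : ∀ v ∉ H, x v ≤ η)
    (hC : m < #{u | ∀ v ∈ H, G.Adj v u}) {v w : Fin n} (hv : v ∈ H) (hw : w ∉ H) : G.Adj v w := by
  have hml := hT.two_mul_add_two_le
  by_contra hvw
  set E : Finset (Fin n) := {w | w ∉ H ∧ ∃ v ∈ H, ¬ G.Adj v w} with hE
  -- The initial `w` is replaced by one with at most `m - 2` neighbours in `E`. Its other neighbours
  -- outside `H` are joined to all of `H`, and `T`-freeness limits their number.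
  obtain ⟨w, hwE, hwd⟩ := exists_degree_lt hT.1 hG.1
    (⟨w, mem_filter.2 ⟨mem_univ _, hw, v, hv, hvw⟩⟩ : E.Nonempty)
  obtain ⟨-, hw, v, hv, hvw⟩ := mem_filter.1 hwE
  set C : Finset (Fin n) := {u | ∀ v ∈ H, G.Adj v u} with hCdef
  have hNC : #(G.neighborFinset w ∩ C) + (l + 1) < m := by
    by_contra! hle
    refine hG.1 (isContained_of_common_neighbors hT (W := insert w H) (P := G.neighborFinset w ∩ C)
      (by rw [card_insert_of_notMem hw, hH]) hle fun a ha u hu => ?_)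
    obtain ⟨hu1, hu2⟩ := mem_inter.1 hu
    rcases mem_insert.1 ha with rfl | ha
    · simpa using hu1
    · exact (mem_filter.1 hu2).2 a ha
  have hsub : G.neighborFinset w \ H ⊆ {u ∈ E | G.Adj w u} ∪ (G.neighborFinset w ∩ C) := by
    intro u hu
    obtain ⟨hu1, hu2⟩ := mem_sdiff.1 hu
    by_cases huE : u ∈ E
    · exact mem_union_left _ (mem_filter.2 ⟨huE, by simpa using hu1⟩)
    · refine mem_union_right _ (mem_inter.2 ⟨hu1, mem_filter.2 ⟨mem_univ _, fun a ha => ?_⟩⟩)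
      by_contra h
      exact huE (mem_filter.2 ⟨mem_univ _, hu2, a, ha, h⟩)
  have hcard : (#(G.neighborFinset w \ H) : ℝ) ≤ 3 * ((m : ℝ) - l - 1) := by
    have h1 := (card_le_card hsub).trans (card_union_le _ _)
    have h2 : (#(G.neighborFinset w \ H) : ℝ) + 3 * (l + 1) ≤ 3 * m := by
      exact_mod_cast (by omega : #(G.neighborFinset w \ H) + 3 * (l + 1) ≤ 3 * m)
    linarith
  have hlt : lam G * x w < ∑ v ∈ H, x v := by
    have h1 : lam G * x w = ∑ u ∈ G.neighborFinset w, x u := by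
      rw [← adj_mulVec, he, Pi.smul_apply, smul_eq_mul]
    have h2 : ∑ u ∈ G.neighborFinset w \ H, x u ≤ 3 / 5 := by
      calc _ ≤ ∑ u ∈ G.neighborFinset w \ H, η := sum_le_sum fun u hu => hxH' u (mem_sdiff.1 hu).2
        _ = #(G.neighborFinset w \ H) * η := by rw [sum_const, nsmul_eq_mul]
        _ ≤ 3 * ((m : ℝ) - l - 1) * η := mul_le_mul_of_nonneg_right hcard hη0
        _ ≤ 3 / 5 := by linarith
    -- The missing neighbour `v` costs more than 3/5, which the light neighbours cannot make up.
    have h3 : ∑ u ∈ G.neighborFinset w ∩ H, x u ≤ ∑ u ∈ H.erase v, x u := by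
      refine sum_le_sum_of_subset_of_nonneg (fun u hu => ?_) fun u _ _ => hx u
      obtain ⟨hu1, hu2⟩ := mem_inter.1 hu
      refine mem_erase.2 ⟨?_, hu2⟩
      rintro rfl
      rw [SimpleGraph.mem_neighborFinset] at hu1
      exact hvw hu1.symm
    rw [h1, ← sum_inter_add_sum_sdiff _ H, ← add_sum_erase H _ hv]
    linarith [hxH v hv]
  refine (lam_lt_lam_rewire hx he hw hlt).not_ge ?_
  rw [hG.2]
  exact le_spex (rewire_free hG.1 (by rwa [Fintype.card_fin]))

/-! ### Parameters and the structure of the heavy set -/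

theorem error_le {m l n α ε k c B : ℝ} (hm : 0 < m) (hl : 1 ≤ l) (hn : 0 ≤ n) (hα : 0 < α)
    (hε : 0 < ε) (hε' : ε * 64 < 1) (hα' : α * (10 * m) < ε ^ 2) (hk : 0 ≤ k)
    (hk' : α * k ≤ 4 * m ^ 2) (hc : 0 ≤ c) (hcB : c ≤ B) (hnl : l ^ 2 ≤ n * ε ^ 2)
    (hnB : 50 * m ^ 3 * l * B ≤ n * (ε * α)) :
    m * c * k + 2 * m * (10 * α) * n + l ^ 2 ≤ ε / 2 * n := by
  have hB : 0 ≤ B := hc.trans hcB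
  -- The three errors receive shares `ε/4`, `ε/8` and `ε/8` of `n`, so that `σ = ε/2`.
  have h1 : m * c * k ≤ ε / 4 * n := by
    refine le_of_mul_le_mul_left (a := α) ?_ hα
    calc α * (m * c * k) = m * c * (α * k) := by ring
      _ ≤ m * B * (4 * m ^ 2) :=
        mul_le_mul (mul_le_mul_of_nonneg_left hcB hm.le) hk' (by positivity) (by positivity)
      _ = 4 * (m ^ 3 * B) := by ring
      _ ≤ α * (ε / 4 * n) := by
        have h5 : m ^ 3 * B ≤ m ^ 3 * B * l := le_mul_of_one_le_right (by positivity) hl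
        have h6 : 0 ≤ m ^ 3 * B := by positivity
        linarith
  have hε2 : ε ^ 2 * 64 ≤ ε := by
    have := mul_lt_mul_of_pos_left hε' hε
    linarith
  have h2 : 2 * m * (10 * α) * n ≤ ε / 8 * n := mul_le_mul_of_nonneg_right (by linarith) hn
  have h3 : l ^ 2 ≤ ε / 8 * n := by
    have := mul_le_mul_of_nonneg_left hε2 hn
    have : 0 ≤ n * ε := by positivity
    linarith
  linarith

theorem threshold_pos {m l : ℕ} {ε α : ℝ} (hm : 0 < m) (hα : 0 < α) : 0 < threshold m l ε α :=
  lt_max_of_lt_left (by positivity)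

theorem Admissible.bounds {m l n : ℕ} {η ε α : ℝ} (hA : Admissible m l η ε α) (hl : 1 ≤ l)
    (hml : 2 * l + 2 ≤ m) (hn : threshold m l ε α ≤ n) :
    (η * ((m : ℝ) - l - 1) ≤ 1 / 5 ∧ η ≤ 1 / 2) ∧
    (ε * 64 < 1 ∧ ε * (16 * (l : ℝ) ^ 2 * m) < 1 ∧ ε * (32 * (l ^ 2 * m)) ≤ η - 3 * (ε / 2)) ∧
    (10 * α ≤ η ∧ α * (10 * m) < ε ^ 2) ∧
    (131072 * (m : ℝ) ^ 6 < n * (10 * α) ^ 4 ∧ 4 * (m : ℝ) < n ∧ (l : ℝ) ^ 2 ≤ n * ε ^ 2 ∧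
      50 * (m : ℝ) ^ 3 * l * (Nat.choose ⌊50 * (m : ℝ) ^ 2 * l / α⌋₊ l : ℝ) ≤ n * (ε * α)) := by
  obtain ⟨hη, hε, hα, hη', hε', hα'⟩ := hA
  rw [lt_min_iff] at hη' hα'
  rw [lt_min_iff, lt_min_iff] at hε'
  obtain ⟨hη1, hη2⟩ := hη'
  obtain ⟨hε1, hε2, hε3⟩ := hε'
  obtain ⟨hα1, hα2⟩ := hα'
  simp only [threshold, max_le_iff] at hn
  obtain ⟨hn1, -, hn3, hn4, -⟩ := hn
  have hl' : (1 : ℝ) ≤ l := by exact_mod_cast hl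
  have hml' : 2 * (l : ℝ) + 2 ≤ m := by exact_mod_cast hml
  have hl0 : (0 : ℝ) < l := by linarith
  have hm0 : (0 : ℝ) < m := by linarith
  have hlm : (0 : ℝ) < (l : ℝ) ^ 2 * m := by positivity
  have hl2 : (1 : ℝ) ≤ (l : ℝ) ^ 2 := one_le_pow₀ hl'
  have hmlm : (m : ℝ) ≤ (l : ℝ) ^ 2 * m := le_mul_of_one_le_left hm0.le hl2
  rw [div_le_iff₀ (by positivity)] at hn1 hn3
  rw [div_mul_eq_mul_div, div_le_iff₀ (by positivity)] at hn4
  rw [lt_div_iff₀ (by positivity)] at hη1 hε1 hε3 hα2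
  rw [lt_div_iff₀ (by linarith)] at hη2
  have hη5 : η * ((m : ℝ) - l - 1) ≤ 1 / 5 := by
    have : 1 / (20 * (l : ℝ) ^ 2 * m) ≤ 1 / (16 * (l : ℝ) * m) := by
      refine one_div_le_one_div_of_le (by positivity) ?_
      nlinarith [mul_le_mul_of_nonneg_right hl' (by positivity : (0:ℝ) ≤ l * m)]
    linarith
  have hη2' : η ≤ 1 / 2 := by nlinarith
  have hεm : ε * (16 * m) < 1 := by
    have := mul_le_mul_of_nonneg_left hmlm (by linarith : 0 ≤ 16 * ε)
    linarith
  have hε64 : ε * 64 < 1 := by nlinarith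
  have hm1 : (1 : ℝ) ≤ m := by linarith
  have hεη : ε * (32 * (l ^ 2 * m)) ≤ η - 3 * (ε / 2) := by linarith
  have hnε : 1 ≤ n * ε ^ 2 := hl2.trans hn3
  -- This follows from `n ε² ≥ 1` and `16 m ε < 1`.
  have hnm : 256 * (m : ℝ) ^ 2 ≤ n := by
    have h1 : (ε * (16 * m)) ^ 2 ≤ 1 := pow_le_one₀ (by positivity) hεm.le
    have h2 : (n : ℝ) * (ε * (16 * m)) ^ 2 ≤ n * 1 := mul_le_mul_of_nonneg_left h1 (Nat.cast_nonneg _)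
    have h3 := mul_le_mul_of_nonneg_right hnε (by positivity : 0 ≤ 256 * (m : ℝ) ^ 2)
    nlinarith
  have hnm' : 4 * (m : ℝ) < n := by nlinarith
  have hαη : 10 * α ≤ η := by
    have h1 : ε ^ 2 ≤ ε := by rw [pow_two]; exact mul_le_of_le_one_left hε.le (by linarith)
    have h2 : α * 10 ≤ α * (10 * m) := mul_le_mul_of_nonneg_left (by linarith) hα.le
    linarith
  have hnα : 131072 * (m : ℝ) ^ 6 < n * (10 * α) ^ 4 := by
    have : 0 < (m : ℝ) ^ 6 := by positivity
    calc _ < 10000 * (200 * (m : ℝ) ^ 6) := by linarith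
      _ ≤ 10000 * (n * α ^ 4) := mul_le_mul_of_nonneg_left hn1 (by norm_num)
      _ = _ := by ring
  exact ⟨⟨hη5, hη2'⟩, ⟨hε64, hε1, hεη⟩, ⟨hαη, hα2⟩, hnα, hnm', hn3, hn4⟩

theorem heavy_structure {m l δ : ℕ} {T : SimpleGraph (Fin m)} (hl : 1 ≤ l)
    (hT : InTreeFamily T l δ) {η ε α : ℝ} (hA : Admissible m l η ε α) {n : ℕ}
    (hn : threshold m l ε α ≤ n) {G : SimpleGraph (Fin n)} (hG : G ∈ SPEX n T) {x : Fin n → ℝ}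
    (hx : IsPerronVector G x) :
    #{v | η ≤ x v} = l ∧ ∀ v w, η ≤ x v → x w < η → G.Adj v w := by
  have hml := hT.two_mul_add_two_le
  obtain ⟨⟨hη5, hη2'⟩, ⟨hε64, hε1, hεη⟩, ⟨hβη, hα2⟩, hnα, hnm', hn3, hn4⟩ := hA.bounds hl hml hn
  obtain ⟨hη, hε, hα, -⟩ := hA
  clear hn
  have hl' : (1 : ℝ) ≤ l := by exact_mod_cast hl
  have hm0 : (0 : ℝ) < m := by exact_mod_cast (by omega : 0 < m)
  have hml' : 2 * (l : ℝ) + 2 ≤ m := by exact_mod_cast hml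
  have hlm : (m : ℝ) ≤ (l : ℝ) ^ 2 * m := le_mul_of_one_le_left hm0.le (one_le_pow₀ hl')
  have hn0 : (0 : ℝ) < n := by linarith
  set B := (Nat.choose ⌊50 * (m : ℝ) ^ 2 * l / α⌋₊ l : ℝ) with hB
  have hnmN : 4 * m < n := by exact_mod_cast hnm'
  have P := hx.perronSetting hT hl (by omega) hG
  -- The factor 10 turns `200 m⁶ ≤ n α⁴` into the bound with `131072` and gives `α #L ≤ 4m²`.
  set β := 10 * α with hβ
  have hβ0 : 0 < β := by positivity
  set L : Finset (Fin n) := {v | β ≤ x v} with hL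
  have hLcard : β * (#L : ℝ) ≤ 32 * (m : ℝ) ^ 2 :=
    P.card_heavy_le (by omega) (by omega) hβ0 hnα
  have hLα : α * (#L : ℝ) ≤ 4 * (m : ℝ) ^ 2 := by
    rw [hβ, mul_assoc] at hLcard
    linarith [sq_nonneg (m : ℝ)]
  have hLB : ((#L).choose l : ℝ) ≤ B := by
    rw [hB]
    refine Nat.cast_le.2 (Nat.choose_le_choose _ (Nat.le_floor ?_))
    rw [le_div_iff₀ hα]
    linarith [mul_le_mul_of_nonneg_left hl' (by positivity : 0 ≤ 50 * (m : ℝ) ^ 2),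
      sq_nonneg (m : ℝ)]
  have hLx : ∀ w ∉ L, x w ≤ β := fun w hw => by
    by_contra! h
    exact hw (mem_filter.2 ⟨mem_univ _, h.le⟩)
  have hσ : (m : ℝ) * (#L).choose l * #L + 2 * m * β * n + (l : ℝ) ^ 2 ≤ ε / 2 * n :=
    error_le hm0 hl' hn0.le hα hε hε64 hα2
      (Nat.cast_nonneg _) hLα (Nat.cast_nonneg _) hLB hn3 hn4
  obtain ⟨z, hz⟩ := hx.2.2.1
  have hzL : z ∈ L := mem_filter.2 ⟨mem_univ _, by rw [hz]; linarith⟩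
  set H : Finset (Fin n) := {v | η ≤ x v} with hH
  -- The gap estimate with `σ = ε/2`, where `η - 3σ ≥ 32 l² m ε`.
  have hHx : ∀ v ∈ H, (1 - x v) * (64 * (l ^ 2 * m)) ≤ 1 := by
    intro v hv
    have hv' : η ≤ x v := (mem_filter.1 hv).2
    have h1 := P.one_sub_le hβ0.le (by omega) hLx hσ hz
      (mem_filter.2 ⟨mem_univ _, hβη.trans hv'⟩) hv'
    have h2 := mul_le_mul_of_nonneg_left hεη (sub_nonneg.2 (P.le_one v))
    have h3 : ε * ((1 - x v) * (64 * (l ^ 2 * m))) ≤ ε * 1 := by linarith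
    exact le_of_mul_le_mul_left h3 hε
  have hHx' : ∀ v ∈ H, 3 / 5 < x v := by
    intro v hv
    have h1 := hHx v hv
    have h2 : (1 - x v) * 64 ≤ (1 - x v) * (64 * (l ^ 2 * m)) :=
      mul_le_mul_of_nonneg_left (by linarith) (sub_nonneg.2 (P.le_one v))
    linarith
  have hHd : ∀ v ∈ H, (n : ℝ) - n / (16 * (l ^ 2 * m)) ≤ #(G.neighborFinset v) := by
    intro v hv
    refine le_trans ?_ (P.card_neighborFinset_ge hβ0.le hLx hσ v)
    have h1 : 1 - x v ≤ 1 / (64 * (l ^ 2 * m)) := by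
      rw [le_div_iff₀ (by positivity)]; exact hHx v hv
    have h2 : ε / 2 ≤ 1 / (32 * (l ^ 2 * m)) := by
      rw [le_div_iff₀ (by positivity)]; linarith
    have h3 : 1 / (64 * ((l : ℝ) ^ 2 * m)) + 1 / (32 * (l ^ 2 * m)) ≤ 1 / (16 * (l ^ 2 * m)) := by
      field_simp; norm_num
    have h4 : (n : ℝ) - n / (16 * (l ^ 2 * m)) = (1 - 1 / (16 * (l ^ 2 * m))) * n := by ring
    rw [h4]
    exact mul_le_mul_of_nonneg_right (by linarith) hn0.le
  -- Up to `l + 1` vertices, each missing at most `n/(16 l² m)` others, keep `n/2 > m` common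
  -- neighbours. Size `l + 1` bounds `#H`; size `l` permits rewiring.
  have hcommon : ∀ S ⊆ H, #S ≤ l + 1 → m < #{u | ∀ v ∈ S, G.Adj v u} := by
    intro S hS hSl
    have h1 := card_commonNeighbors_ge (fun v hv => hHd v (hS hv))
    have h2 : (#S : ℝ) * (n / (16 * (l ^ 2 * m))) ≤ n / 2 := by
      rw [← mul_div_assoc, div_le_div_iff₀ (by positivity) (by norm_num)]
      have h3 : (#S : ℝ) ≤ l + 1 := by exact_mod_cast hSl
      have h4 : (#S : ℝ) * 2 ≤ 16 * (l ^ 2 * m) := by linarith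
      linarith [mul_le_mul_of_nonneg_right h4 hn0.le]
    have h3 : (m : ℝ) < #{u | ∀ v ∈ S, G.Adj v u} := by linarith
    exact_mod_cast h3
  have hHle : #H ≤ l := by
    by_contra! hlt
    obtain ⟨S, hS, hSc⟩ := exists_subset_card_eq (show l + 1 ≤ #H from hlt)
    exact hG.1 (isContained_of_common_neighbors hT hSc
      (Nat.le_add_right_of_le (hcommon S hS hSc.le).le) fun a ha u hu => (mem_filter.1 hu).2 a ha)
  have hHge : l ≤ #H := P.le_card_veryHeavy hβ0.le (by omega) hLx hσ hz hzL hη2' (by linarith)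
  have hHl : #H = l := le_antisymm hHle hHge
  refine ⟨hHl, fun v w hv hw => ?_⟩
  exact adj_of_heavy hT hG hx.1 hx.2.1 hHl hη.le hη5 hHx'
    (fun v hv => by
      by_contra! h
      exact hv (mem_filter.2 ⟨mem_univ _, h.le⟩))
    (hcommon H subset_rfl (by omega)) (mem_filter.2 ⟨mem_univ _, hv⟩)
    (fun h => hw.not_ge (mem_filter.1 h).2)

theorem completeBipartiteGraph_isContained {n l : ℕ} {G : SimpleGraph (Fin n)}
    {H : Finset (Fin n)} (hH : #H = l) (h : ∀ v ∈ H, ∀ w ∉ H, G.Adj v w) :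
    (completeBipartiteGraph (Fin l) (Fin (n - l))).IsContained G := by
  obtain ⟨f⟩ : Nonempty (Fin l ↪ H) := Function.Embedding.nonempty_of_card_le (by simp [hH])
  obtain ⟨g⟩ : Nonempty (Fin (n - l) ↪ (Hᶜ : Finset (Fin n))) :=
    Function.Embedding.nonempty_of_card_le (by simp [hH])
  refine ⟨⟨⟨Sum.elim (fun a => (f a : Fin n)) (fun b => (g b : Fin n)), ?_⟩, ?_⟩⟩
  · rintro (a | a) (b | b) hab
    · simp at hab
    · exact h _ (f a).2 _ (mem_compl.1 (g b).2)
    · exact (h _ (f b).2 _ (mem_compl.1 (g a).2)).symm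
    · simp at hab
  · refine Function.Injective.sumElim (Subtype.val_injective.comp f.injective)
      (Subtype.val_injective.comp g.injective) fun a b hab => ?_
    exact mem_compl.1 (g b).2 (hab ▸ (f a).2)

theorem completeBipartiteGraph_isContained_of_threshold_le {m l δ : ℕ} {T : SimpleGraph (Fin m)}
    (hl : 1 ≤ l) (hT : InTreeFamily T l δ) {η ε α : ℝ} (hA : Admissible m l η ε α) {n : ℕ}
    (hn : threshold m l ε α ≤ n) {G : SimpleGraph (Fin n)} (hG : G ∈ SPEX n T) :
    (completeBipartiteGraph (Fin l) (Fin (n - l))).IsContained G := by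
  have hn0 : 0 < n := by
    have hm : 0 < m := by have := hT.two_mul_add_two_le; omega
    exact_mod_cast (threshold_pos hm hA.2.2.1).trans_le hn
  obtain ⟨x, hx⟩ := exists_isPerronVector hn0 G
  obtain ⟨h1, h2⟩ := heavy_structure hl hT hA hn hG hx
  exact completeBipartiteGraph_isContained h1 fun v hv w hw =>
    h2 v w (mem_filter.1 hv).2 (by
      by_contra! h
      exact hw (mem_filter.2 ⟨mem_univ _, h⟩))

/-! ### Explicit parameters -/

theorem admissible_explicit {m l : ℕ} (hl : 1 ≤ l) (hm : 2 * l + 2 ≤ m) :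
    Admissible m l (1 / (10 * m)) (1 / (1000 * (l : ℝ) ^ 2 * m ^ 2))
      (1 / (20000000 * (l : ℝ) ^ 4 * m ^ 5)) := by
  have hl' : (1 : ℝ) ≤ l := by exact_mod_cast hl
  have hm' : 2 * (l : ℝ) + 2 ≤ m := by exact_mod_cast hm
  have hl0 : (0 : ℝ) < l := by linarith
  have hm0 : (0 : ℝ) < m := by linarith
  have hm1 : (1 : ℝ) ≤ m := by linarith
  have hl2 : (1 : ℝ) ≤ (l : ℝ) ^ 2 := one_le_pow₀ hl'
  refine ⟨by positivity, by positivity, by positivity, lt_min ?_ ?_,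
    lt_min ?_ (lt_min ?_ ?_), lt_min ?_ ?_⟩
  · exact one_div_lt_one_div_of_lt (by positivity) (by linarith)
  · rw [lt_div_iff₀ (by linarith)]
    have h1 : 1 / (10 * (m : ℝ)) * (m - l - 1) ≤ 1 / 10 := by
      rw [div_mul_eq_mul_div, div_le_div_iff₀ (by positivity) (by norm_num)]
      linarith
    have h2 : 1 / (16 * (l : ℝ) * m) ≤ 1 / 16 :=
      one_div_le_one_div_of_le (by norm_num) (by nlinarith)
    have h3 : 0 < 1 / (20 * (l : ℝ) ^ 2 * m) := by positivity
    linarith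
  · refine one_div_lt_one_div_of_lt (by positivity) ?_
    nlinarith [mul_le_mul_of_nonneg_left hm1 (by positivity : 0 ≤ (l : ℝ) ^ 2 * m),
      (by positivity : 0 < (l : ℝ) ^ 2 * m)]
  · rw [div_div]
    refine one_div_lt_one_div_of_lt (by positivity) ?_
    nlinarith [mul_le_mul_of_nonneg_left hm1 hm0.le,
      mul_le_mul_of_nonneg_right hl2 (by positivity : 0 ≤ (m : ℝ) ^ 2)]
  · rw [div_div]
    refine one_div_lt_one_div_of_lt (by positivity) ?_
    nlinarith [mul_le_mul_of_nonneg_left hm1 hm0.le,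
      mul_le_mul_of_nonneg_right hl2 (by positivity : 0 ≤ (m : ℝ) ^ 2)]
  · refine one_div_lt_one_div_of_lt (by positivity) ?_
    have h1 : (1 : ℝ) ≤ (l : ℝ) ^ 4 * m ^ 4 := one_le_mul_of_one_le_of_one_le (one_le_pow₀ hl') (one_le_pow₀ hm1)
    nlinarith
  · rw [lt_div_iff₀ (by positivity)]
    -- The choice of `α` makes `10 m α` exactly half of `ε²`.
    have : 1 / (20000000 * (l : ℝ) ^ 4 * m ^ 5) * (10 * m) = (1 / 2) * (1 / (1000 * (l : ℝ) ^ 2 * m ^ 2)) ^ 2 := by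
      field_simp; norm_num
    rw [this]
    have : 0 < (1 / (1000 * (l : ℝ) ^ 2 * m ^ 2)) ^ 2 := by positivity
    linarith

/-- Only the binomial term has an exponent growing with `l`: its upper entry is at most `10⁹ m¹²`,
hence `m^(12l)`. The 42 comes from the first term, of order `l¹⁶ m²⁶`, using `l ≤ m`. -/
theorem threshold_explicit_le {m l : ℕ} (hl : 1 ≤ l) (hm : 2 * l + 2 ≤ m) :
    threshold m l (1 / (1000 * (l : ℝ) ^ 2 * m ^ 2)) (1 / (20000000 * (l : ℝ) ^ 4 * m ^ 5))
      ≤ (10 ^ 32 : ℝ) ^ l * (m : ℝ) ^ (12 * l + 42) := by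
  have hl' : (1 : ℝ) ≤ l := by exact_mod_cast hl
  have hlm : (l : ℝ) ≤ m := by exact_mod_cast (by omega : l ≤ m)
  have hl0 : (0 : ℝ) < l := by linarith
  have hm0 : (0 : ℝ) < m := by linarith
  have hm1 : (1 : ℝ) ≤ m := by linarith
  have hD : (10 : ℝ) ^ 32 ≤ (10 ^ 32 : ℝ) ^ l := le_self_pow₀ (by norm_num) (by omega)
  have key : ∀ (c : ℝ) (i j : ℕ), 0 ≤ c → c ≤ 10 ^ 32 → i + j ≤ 42 →
      c * ((l : ℝ) ^ i * m ^ j) ≤ (10 ^ 32 : ℝ) ^ l * (m : ℝ) ^ (12 * l + 42) := by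
    intro c i j hc0 hc hij
    refine mul_le_mul (hc.trans hD) ?_ (by positivity) (by positivity)
    calc (l : ℝ) ^ i * m ^ j ≤ (m : ℝ) ^ i * m ^ j := by gcongr
      _ = (m : ℝ) ^ (i + j) := (pow_add _ _ _).symm
      _ ≤ _ := pow_le_pow_right₀ hm1 (by omega)
  refine max_le ?_ (max_le ?_ (max_le ?_ (max_le ?_ ?_)))
  · refine le_of_eq_of_le ?_ (key (200 * 20000000 ^ 4) 16 26 (by norm_num) (by norm_num) (by norm_num))
    field_simp
  · refine le_of_eq_of_le ?_ (key (2500 * 20000000 ^ 3) 14 18 (by norm_num) (by norm_num) (by norm_num))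
    field_simp
  · refine le_of_eq_of_le ?_ (key (1000 ^ 2) 6 4 (by norm_num) (by norm_num) (by norm_num))
    field_simp
  · have h1 : 50 * (m : ℝ) ^ 2 * l / (1 / (20000000 * (l : ℝ) ^ 4 * m ^ 5)) ≤ 10 ^ 9 * m ^ 12 := by
      calc _ = 10 ^ 9 * ((l : ℝ) ^ 5 * m ^ 7) := by field_simp; norm_num
        _ ≤ 10 ^ 9 * ((m : ℝ) ^ 5 * m ^ 7) := by gcongr
        _ = _ := by ring
    have h2 : (Nat.choose ⌊50 * (m : ℝ) ^ 2 * l / (1 / (20000000 * (l : ℝ) ^ 4 * m ^ 5))⌋₊ l : ℝ)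
        ≤ (10 ^ 9 * m ^ 12) ^ l := by
      refine (Nat.cast_le.2 (Nat.choose_le_pow _ _)).trans ?_
      rw [Nat.cast_pow]
      exact pow_le_pow_left₀ (Nat.cast_nonneg _) ((Nat.floor_le (by positivity)).trans h1) _
    have h3 : 50 * (m : ℝ) ^ 3 * l / (1 / (1000 * (l : ℝ) ^ 2 * m ^ 2) * (1 / (20000000 * (l : ℝ) ^ 4 * m ^ 5)))
        ≤ 10 ^ 12 * m ^ 17 := by
      calc _ = 10 ^ 12 * ((l : ℝ) ^ 7 * m ^ 10) := by field_simp; norm_num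
        _ ≤ 10 ^ 12 * ((m : ℝ) ^ 7 * m ^ 10) := by gcongr
        _ = _ := by ring
    calc _ ≤ 10 ^ 12 * (m : ℝ) ^ 17 * (10 ^ 9 * m ^ 12) ^ l :=
          mul_le_mul h3 h2 (Nat.cast_nonneg _) (by positivity)
      _ = 10 ^ 12 * (10 ^ 9) ^ l * (m : ℝ) ^ (12 * l + 17) := by rw [mul_pow, ← pow_mul, pow_add]; ring
      _ ≤ _ := by
        refine mul_le_mul ?_ (pow_le_pow_right₀ hm1 (by omega)) (by positivity) (by positivity)
        calc (10 : ℝ) ^ 12 * (10 ^ 9) ^ l ≤ (10 ^ 12) ^ l * (10 ^ 9) ^ l := by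
              gcongr
              exact le_self_pow₀ (by norm_num) (by omega)
          _ = (10 ^ 21) ^ l := by rw [← mul_pow]; norm_num
          _ ≤ _ := by gcongr <;> norm_num
  · refine le_of_eq_of_le ?_ (key (200 * 20000000 * 1000) 7 9 (by norm_num) (by norm_num) (by norm_num))
    field_simp

/-! ### The threshold function as a supremum -/

/-- The orders `n` for which some spectral extremal graph does not contain `K_{l, n - l}`. -/
def exceptionalOrders (m l : ℕ) : Set ℕ :=
  {n | ∃ (δ : ℕ) (T : SimpleGraph (Fin m)) (G : SimpleGraph (Fin n)), InTreeFamily T l δ ∧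
    G ∈ SPEX n T ∧ ¬ (completeBipartiteGraph (Fin l) (Fin (n - l))).IsContained G}

theorem lt_threshold_of_mem_exceptionalOrders {m l : ℕ} (hl : 1 ≤ l) {η ε α : ℝ}
    (hA : Admissible m l η ε α) {n : ℕ} (hn : n ∈ exceptionalOrders m l) :
    (n : ℝ) < threshold m l ε α := by
  obtain ⟨δ, T, G, hT, hG, hnot⟩ := hn
  by_contra! h
  exact hnot (completeBipartiteGraph_isContained_of_threshold_le hl hT hA h hG)

theorem exceptionalOrders_zero (m : ℕ) : exceptionalOrders m 0 = ∅ := by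
  refine Set.eq_empty_iff_forall_notMem.2 ?_
  rintro n ⟨δ, T, G, -, -, h⟩
  exact h (completeBipartiteGraph_isContained (H := ∅) rfl (by simp))

theorem bddAbove_exceptionalOrders (m l : ℕ) : BddAbove (exceptionalOrders m l) := by
  rcases Nat.eq_zero_or_pos l with rfl | hl
  · rw [exceptionalOrders_zero]; exact bddAbove_empty
  · refine ⟨⌊threshold m l (1 / (1000 * (l : ℝ) ^ 2 * m ^ 2))
      (1 / (20000000 * (l : ℝ) ^ 4 * m ^ 5))⌋₊, fun n hn => Nat.le_floor ?_⟩
    have hm : 2 * l + 2 ≤ m := by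
      obtain ⟨δ, T, G, hT, -⟩ := hn
      exact hT.two_mul_add_two_le
    exact (lt_threshold_of_mem_exceptionalOrders hl (admissible_explicit hl hm) hn).le

/-- Strictness survives because a nonempty bounded set of naturals attains its supremum; for the
empty set the supremum is 0. -/
theorem sSup_exceptionalOrders_lt_threshold {m l : ℕ} (hl : 1 ≤ l) (hm : 2 * l + 2 ≤ m)
    {η ε α : ℝ} (hA : Admissible m l η ε α) :
    (sSup (exceptionalOrders m l) : ℕ) < threshold m l ε α := by
  rcases (exceptionalOrders m l).eq_empty_or_nonempty with h | h
  · rw [h, csSup_empty]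
    simpa using threshold_pos (by omega) hA.2.2.1
  · exact lt_threshold_of_mem_exceptionalOrders hl hA
      (Nat.sSup_mem h (bddAbove_exceptionalOrders m l))

theorem sSup_exceptionalOrders_le {m l : ℕ} (hl : 1 ≤ l) (hm : 2 * l + 2 ≤ m) :
    ((sSup (exceptionalOrders m l) : ℕ) : ℝ) ≤ (10 ^ 32 : ℝ) ^ l * (m : ℝ) ^ (12 * l + 42) :=
  (sSup_exceptionalOrders_lt_threshold hl hm (admissible_explicit hl hm)).le.trans
    (threshold_explicit_le hl hm)

/-- Since `m ≥ l + 2`, the factor `D` is at most `m^(log D / log(l+2))`, an exponent tending to 0,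
so constants to the power `l` go into the `o(1)`. -/
theorem pow_mul_pow_le_rpow {D : ℝ} (hD : 1 ≤ D) {m l : ℕ} (hm : l + 2 ≤ m) :
    D ^ l * (m : ℝ) ^ (12 * l + 42)
      ≤ (m : ℝ) ^ ((12 + Real.log D / Real.log (l + 2)) * (l : ℝ) + 42) := by
  have hm' : (l : ℝ) + 2 ≤ m := by exact_mod_cast hm
  have hl0 : (0 : ℝ) ≤ l := Nat.cast_nonneg _
  have hm0 : (0 : ℝ) < m := by linarith
  have hlog : 0 < Real.log ((l : ℝ) + 2) := Real.log_pos (by linarith)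
  have h1 : D ^ l ≤ (m : ℝ) ^ (Real.log D / Real.log (l + 2) * l) := by
    rw [← Real.rpow_natCast, Real.rpow_def_of_pos (by linarith : 0 < D), Real.rpow_def_of_pos hm0,
      Real.exp_le_exp]
    have h2 : Real.log D * 1 ≤ Real.log D * (Real.log m / Real.log (l + 2)) := by
      refine mul_le_mul_of_nonneg_left ?_ (Real.log_nonneg hD)
      rw [one_le_div hlog]
      exact Real.log_le_log (by linarith) hm'
    calc Real.log D * l = Real.log D * 1 * l := by ring
      _ ≤ Real.log D * (Real.log m / Real.log (l + 2)) * l := mul_le_mul_of_nonneg_right h2 hl0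
      _ = _ := by ring
  have h3 : (12 + Real.log D / Real.log (l + 2)) * (l : ℝ) + 42
      = Real.log D / Real.log (l + 2) * l + ((12 * l + 42 : ℕ) : ℝ) := by push_cast; ring
  rw [h3, Real.rpow_add hm0, Real.rpow_natCast]
  exact mul_le_mul_of_nonneg_right h1 (by positivity)

end SpectralTree

theorem theorem1p5 :
    ∃ N : ℕ → ℕ → ℕ,
      -- the explicit bound on the threshold
      (∀ m l : ℕ, 1 ≤ l → 2 * l + 2 ≤ m → ∀ η ε α : ℝ, SpectralTree.Admissible m l η ε α →
        (N m l : ℝ) < SpectralTree.threshold m l ε α) ∧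
      -- its order of magnitude
      (∃ o : ℕ → ℝ, Filter.Tendsto o Filter.atTop (nhds 0) ∧
        ∀ m l : ℕ, 1 ≤ l → 2 * l + 2 ≤ m →
          (N m l : ℝ) ≤ (m : ℝ) ^ ((12 + o l) * (l : ℝ) + 42)) ∧
      (∃ C : ℕ, ∀ m l : ℕ, 1 ≤ l → 2 * l + 2 ≤ m → N m l ≤ m ^ (C * l)) ∧
      -- spectral extremal graphs contain the complete bipartite graph
      (∀ (m l δ : ℕ) (T : SimpleGraph (Fin m)), SpectralTree.InTreeFamily T l δ →
        ∀ n : ℕ, N m l < n → ∀ G ∈ SpectralTree.SPEX n T,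
          (completeBipartiteGraph (Fin l) (Fin (n - l))).IsContained G) ∧
      -- the vertices of very large Perron weight form its side of size `l`
      (∀ (m l δ : ℕ) (T : SimpleGraph (Fin m)), 1 ≤ l → SpectralTree.InTreeFamily T l δ →
        ∀ η ε α : ℝ, SpectralTree.Admissible m l η ε α →
        ∀ n : ℕ, SpectralTree.threshold m l ε α ≤ (n : ℝ) → ∀ G ∈ SpectralTree.SPEX n T,
        ∀ x : Fin n → ℝ, SpectralTree.IsPerronVector G x →
          {v | η ≤ x v}.ncard = l ∧ ∀ v w, η ≤ x v → x w < η → G.Adj v w) := by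
  -- The exceptional orders do not depend on the parameters, so one function lies below the
  -- thresholds of all admissible triples.
  refine ⟨fun m l => sSup (SpectralTree.exceptionalOrders m l), ?_, ?_, ?_, ?_, ?_⟩
  · intro m l hl hm η ε α hA
    exact SpectralTree.sSup_exceptionalOrders_lt_threshold hl hm hA
  · refine ⟨fun l => Real.log (10 ^ 32) / Real.log (l + 2), ?_, fun m l hl hm => ?_⟩
    · refine Filter.Tendsto.const_div_atTop (Real.tendsto_log_atTop.comp ?_) _
      exact Filter.tendsto_atTop_add_const_right _ _ tendsto_natCast_atTop_atTop
    · exact (SpectralTree.sSup_exceptionalOrders_le hl hm).trans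
        (SpectralTree.pow_mul_pow_le_rpow (by norm_num) (by omega))
  -- `108 = 54 + 54`: `10³² ≤ 4⁵⁴ ≤ m⁵⁴`, and `12l + 42 ≤ 54l`.
  · refine ⟨108, fun m l hl hm => ?_⟩
    have hm4 : (4 : ℝ) ≤ m := by exact_mod_cast (by omega : 4 ≤ m)
    have h1 := SpectralTree.sSup_exceptionalOrders_le hl hm
    have h2 : (10 ^ 32 : ℝ) ^ l * (m : ℝ) ^ (12 * l + 42) ≤ (m : ℝ) ^ (108 * l) := by
      calc (10 ^ 32 : ℝ) ^ l * (m : ℝ) ^ (12 * l + 42)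
          ≤ ((m : ℝ) ^ 54) ^ l * (m : ℝ) ^ (54 * l) := by
            refine mul_le_mul (pow_le_pow_left₀ (by norm_num) ?_ _)
              (pow_le_pow_right₀ (by linarith) (by omega)) (by positivity) (by positivity)
            exact le_trans (by norm_num : (10 ^ 32 : ℝ) ≤ 4 ^ 54) (pow_le_pow_left₀ (by norm_num) hm4 _)
        _ = (m : ℝ) ^ (108 * l) := by rw [← pow_mul, ← pow_add]; congr 1; ring
    exact_mod_cast h1.trans h2
  · intro m l δ T hT n hn G hG
    by_contra h
    exact hn.not_ge (le_csSup (SpectralTree.bddAbove_exceptionalOrders m l) ⟨δ, T, G, hT, hG, h⟩)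
  · intro m l δ T hl hT η ε α hA n hn G hG x hx
    obtain ⟨h1, h2⟩ := SpectralTree.heavy_structure hl hT hA hn hG hx
    refine ⟨?_, h2⟩
    rw [← h1, ← Set.ncard_coe_finset]
    congr 1
    ext v
    simp
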